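/- **Quantum Rényi-$p$ entropy power inequality.** Let $D\ge 1$ and consider $D$ bosonic modes on $L^2(\mathbb R^D)$, with quadratures $\hat x=(\hat q_1,\hat p_1,\dots,\hat q_D,\hat p_D)$ normalised by $[\hat x_j,\hat x_k]=2i\Gamma_{jk}$, where $\Gamma=\bigoplus_{j=1}^D\begin{pmatrix}0&1\\-1&0\end{pmatrix}$ (so $\hat q_j=x_j$, $\hat p_j=-2i\,\partial_{x_j}$). Let $\hat D(\eta)=\exp(i\hat x^T\Gamma\eta)$, $\eta\in\mathbb R^{2D}$, be the Weyl operators and $\chi_\rho(\eta)=\mathrm{Tr}(\rho\hat D(\eta))$ the characteristic function of a density operator $\rho$. A density operator is called Gaussian if $\chi_\rho(\eta)=\exp\bigl(-\tfrac12(\Gamma\eta)^TV(\Gamma\eta)+i\,d^T\Gamma\eta\bigr)$ for some $d\in\mathbb R^{2D}$ and some real symmetric matrix $V$. For $s\in\mathbb R$ the $s$-ordered quasi-probability distribution of $\rho$ is $$q_\rho(x)=\frac1{(2\pi)^{2D}}\int_{\mathbb R^{2D}}e^{-ix^T\Gamma\eta}\,\chi_\rho(\eta)\,e^{s|\eta|^2/2}\,d\eta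 ,$$ so that $s=0$ gives the Wigner function and $s=-1$ the Husimi function. For $p>1$ let $$S_p(\rho)=\frac1{1-p}\log\int_{\mathbb R^{2D}}q_\rho(x)^p\,dx,\qquad \mathbf V_p(\rho)=\exp\Bigl(\frac1D S_p(\rho)\Bigr).$$ For $\tau\in(0,1)$ let $U_\tau$ be the beam-splitter unitary on $L^2(\mathbb R^D\times\mathbb R^D)$, $(U_\tau\Psi)(x,y)=\Psi(\sqrt\tau\,x-\sqrt{1-\tau}\,y,\ \sqrt{1-\tau}\,x+\sqrt\tau\,y)$, which implements $\hat a_Z=\sqrt\tau\,\hat a_X+\sqrt{1-\tau}\,\hat a_Y$ mode by mode, and let $\rho_X\boxplus_\tau\rho_Y=\mathrm{Tr}_Y[U_\tau(\rho_X\otimes\rho_Y)U_\tau^\dagger]$. Let $\rho_X,\rho_Y$ be $D$-mode Gaussian states, $\tau\in(0,1)$ and $s\in\mathbb R$; if $s>0$, assume in addition that $\chi_{\rho_X}(\eta)e^{s|\eta|^2/2}$ and $\chi_{\rho_Y}(\eta)e^{s|\eta|^2/2}$ are integrable over $\mathbb R^{2D}$ (so that the $s$-ordered distributions are given by convergent integrals).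 Let $p>1$ and $\kappa\ge\frac{p+1}2$. Then $\rho_X\boxplus_\tau\rho_Y$ is a Gaussian state; for each of $\rho_X$, $\rho_Y$ and $\rho_X\boxplus_\tau\rho_Y$ the function $\chi_\rho(\eta)e^{s|\eta|^2/2}$ is integrable, $q_\rho$ is real and nonnegative, and $0<\int q_\rho^p<\infty$; and $$\mathbf V_p(\rho_X\boxplus_\tau\rho_Y)^\kappa\ \ge\ \tau^\kappa\,\mathbf V_p(\rho_X)^\kappa+(1-\tau)^\kappa\,\mathbf V_p(\rho_Y)^\kappa .$$ -/

import Mathlib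

open MeasureTheory

open scoped InnerProductSpace ENNReal

noncomputable section

namespace Bosonic

/-! ### Hilbert spaces: bases, trace, density operators -/

section Trace

variable (H : Type*) [NormedAddCommGroup H] [InnerProductSpace ℂ H] [CompleteSpace H]

/-- The index set of a fixed Hilbert basis of `H`. -/
def BasisIdx : Set H := (exists_hilbertBasis ℂ H).choose

/-- A fixed Hilbert basis (orthonormal basis) of `H`. -/
def basis : HilbertBasis (BasisIdx H) ℂ H := (exists_hilbertBasis ℂ H).choose_spec.choose

variable {H}

/-- The trace `Tr T = ∑ᵢ ⟨eᵢ, T eᵢ⟩`; on trace-class operators it does not depend on the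
orthonormal basis. -/
def trace (T : H →L[ℂ] H) : ℂ := ∑' i : BasisIdx H, ⟪basis H i, T (basis H i)⟫_ℂ

/-- Density operators (quantum states): positive operators of trace one. -/
def IsDensityOperator (ρ : H →L[ℂ] H) : Prop := ρ.IsPositive ∧ trace ρ = 1

end Trace

/-! ### The Hilbert space of `D` modes -/

/-- Position space `ℝ^D` of `D` modes. -/
abbrev Pos (D : ℕ) := EuclideanSpace ℝ (Fin D)

/-- Phase space `ℝ^{2D}`; `x (j, 0)` is the position `q_j` and `x (j, 1)` the momentum `p_j`. -/
abbrev Phase (D : ℕ) := EuclideanSpace ℝ (Fin D × Fin 2)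

/-- The Hilbert space `L²(ℝ^D)` of `D` modes. -/
abbrev ModeSpace (D : ℕ) := Lp ℂ 2 (volume : Measure (Pos D))

/-- The Hilbert space `L²(ℝ^D × ℝ^D)` of two systems of `D` modes each. -/
abbrev PairSpace (D : ℕ) := Lp ℂ 2 (volume : Measure (Pos D × Pos D))

/-! ### Weyl operators and the characteristic function -/

/-- The symplectic form `xᵀ Γ η`, with `Γ` the direct sum of `D` blocks `!![0, 1; -1, 0]`. -/
def symp {D : ℕ} (x η : Phase D) : ℝ := ∑ j, (x (j, 0) * η (j, 1) - x (j, 1) * η (j, 0))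

/-- The vector `Γ η`. -/
def sympVec {D : ℕ} (η : Phase D) : Fin D × Fin 2 → ℝ :=
  fun k => if k.2 = 0 then η (k.1, 1) else - η (k.1, 0)

/-- The position part of a phase-space vector. -/
def posPart {D : ℕ} (η : Phase D) : Pos D := WithLp.toLp 2 fun j => η (j, 0)

/-- The phase factor `exp (i ∑ⱼ vⱼ (xⱼ - uⱼ))` of the Weyl operator, where `η = (u, v)`. -/
def weylPhase {D : ℕ} (η : Phase D) (x : Pos D) : ℂ :=
  Complex.exp (Complex.I * ((∑ j, η (j, 1) * (x j - η (j, 0)) : ℝ) : ℂ))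

lemma norm_weylPhase {D : ℕ} (η : Phase D) (x : Pos D) : ‖weylPhase η x‖ = 1 := by
  rw [weylPhase, mul_comm]; exact Complex.norm_exp_ofReal_mul_I _

lemma continuous_weylPhase {D : ℕ} (η : Phase D) : Continuous (weylPhase η) := by
  unfold weylPhase; fun_prop

lemma measurePreserving_shift {D : ℕ} (η : Phase D) :
    MeasurePreserving (fun x : Pos D => x - (2 : ℝ) • posPart η) volume volume :=
  measurePreserving_sub_right volume _

lemma memLp_weyl {D : ℕ} (η : Phase D) (f : ModeSpace D) :
    MemLp (fun x => weylPhase η x * f (x - (2 : ℝ) • posPart η)) 2 (volume : Measure (Pos D)) := by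
  have h := (Lp.memLp f).comp_measurePreserving (measurePreserving_shift η)
  refine (memLp_congr_norm ?_ h.1 ?_).2 h
  · exact (continuous_weylPhase η).aestronglyMeasurable.mul h.1
  · exact Filter.Eventually.of_forall fun x => by simp [norm_weylPhase]

lemma shift_ae {D : ℕ} (η : Phase D) {P : Pos D → Prop} (h : ∀ᵐ x, P x) :
    ∀ᵐ x : Pos D, P (x - (2 : ℝ) • posPart η) :=
  (measurePreserving_shift η).quasiMeasurePreserving.ae h

/-- The Weyl operator `D(η) = exp(i x̂ᵀ Γ η) = exp(i ∑ⱼ (vⱼ q̂ⱼ - uⱼ p̂ⱼ))`, `η = (u, v)`, in the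
Schrödinger representation where `q̂ⱼ` is multiplication by `xⱼ` and `p̂ⱼ = -2i ∂/∂xⱼ`, so that
`[q̂ⱼ, p̂ⱼ] = 2i`: `(D(η) f)(x) = exp(i ∑ⱼ vⱼ (xⱼ - uⱼ)) f(x - 2u)`. -/
def weyl {D : ℕ} (η : Phase D) : ModeSpace D →L[ℂ] ModeSpace D :=
  LinearMap.mkContinuous
    { toFun := fun f => (memLp_weyl η f).toLp _
      map_add' := by
        intro f g
        ext1
        filter_upwards [(memLp_weyl η (f + g)).coeFn_toLp, (memLp_weyl η f).coeFn_toLp,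
          (memLp_weyl η g).coeFn_toLp, Lp.coeFn_add ((memLp_weyl η f).toLp _)
          ((memLp_weyl η g).toLp _), shift_ae η (Lp.coeFn_add f g)] with x h1 h2 h3 h4 h5
        rw [h1, h4, Pi.add_apply, h2, h3, h5, Pi.add_apply, mul_add]
      map_smul' := by
        intro c f
        ext1
        filter_upwards [(memLp_weyl η (c • f)).coeFn_toLp, (memLp_weyl η f).coeFn_toLp,
          Lp.coeFn_smul c ((memLp_weyl η f).toLp _),
          shift_ae η (Lp.coeFn_smul c f)] with x h1 h2 h4 h5
        simp only [RingHom.id_apply]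
        rw [h1, h4, Pi.smul_apply, h2, h5, Pi.smul_apply, smul_eq_mul, smul_eq_mul]
        ring } 1
    (by
      intro f
      simp only [LinearMap.coe_mk, AddHom.coe_mk, one_mul, Lp.norm_toLp]
      rw [Lp.norm_def]
      refine le_of_eq ?_
      congr 1
      rw [← eLpNorm_comp_measurePreserving (Lp.memLp f).1 (measurePreserving_shift η)]
      exact eLpNorm_congr_norm_ae (Filter.Eventually.of_forall fun x => by
        simp [norm_weylPhase]))

/-- The (Wigner) characteristic function `χ(η) = Tr(ρ D(η))`. -/
def charFn {D : ℕ} (ρ : ModeSpace D →L[ℂ] ModeSpace D) (η : Phase D) : ℂ :=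
  trace (ρ ∘L weyl η)

/-- Gaussian states: density operators whose characteristic function is Gaussian,
`χ(η) = exp(-½ (Γη)ᵀ V (Γη) + i dᵀ Γ η)`, with mean `d` and covariance matrix `V`. -/
def IsGaussianState {D : ℕ} (ρ : ModeSpace D →L[ℂ] ModeSpace D) : Prop :=
  IsDensityOperator ρ ∧
    ∃ (d : Phase D) (V : Matrix (Fin D × Fin 2) (Fin D × Fin 2) ℝ), V.IsSymm ∧
      ∀ η : Phase D, charFn ρ η =
        Complex.exp (-(1 / 2 : ℂ) * ((sympVec η ⬝ᵥ V.mulVec (sympVec η) : ℝ) : ℂ) +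
          Complex.I * ((symp d η : ℝ) : ℂ))

/-! ### Tensor products -/

lemma memLp_tmul {D : ℕ} (f g : ModeSpace D) :
    MemLp (fun z : Pos D × Pos D => f z.1 * g z.2) 2 volume := by
  have hf := Lp.memLp f
  have hg := Lp.memLp g
  have hm : AEStronglyMeasurable (fun z : Pos D × Pos D => f z.1 * g z.2) volume :=
    hf.1.comp_fst.mul hg.1.comp_snd
  rw [memLp_two_iff_integrable_sq_norm hm]
  have h1 := (memLp_two_iff_integrable_sq_norm hf.1).1 hf
  have h2 := (memLp_two_iff_integrable_sq_norm hg.1).1 hg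
  have h3 := h1.mul_prod h2
  rw [← Measure.volume_eq_prod] at h3
  simpa [mul_pow] using h3

/-- The product vector `f ⊗ g`, that is `(x, y) ↦ f x * g y`. -/
def tvec {D : ℕ} (f g : ModeSpace D) : PairSpace D := (memLp_tmul f g).toLp _

lemma coeFn_tvec {D : ℕ} (f g : ModeSpace D) :
    tvec f g =ᵐ[volume] fun z : Pos D × Pos D => f z.1 * g z.2 :=
  (memLp_tmul f g).coeFn_toLp

lemma inner_tvec {D : ℕ} (f g f' g' : ModeSpace D) :
    ⟪tvec f g, tvec f' g'⟫_ℂ = ⟪f, f'⟫_ℂ * ⟪g, g'⟫_ℂ := by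
  rw [L2.inner_def, L2.inner_def, L2.inner_def, ← integral_prod_mul]
  refine integral_congr_ae ?_
  filter_upwards [coeFn_tvec f g, coeFn_tvec f' g'] with z h1 h2
  rw [h1, h2]
  simp only [RCLike.inner_apply, map_mul]
  ring

lemma norm_tvec {D : ℕ} (f g : ModeSpace D) : ‖tvec f g‖ = ‖f‖ * ‖g‖ := by
  have h := inner_tvec f g f g
  simp only [inner_self_eq_norm_sq_to_K] at h
  have h' : ‖tvec f g‖ ^ 2 = (‖f‖ * ‖g‖) ^ 2 := by rw [mul_pow]; exact_mod_cast h
  exact (pow_left_inj₀ (norm_nonneg _) (by positivity) two_ne_zero).1 h'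

lemma ae_fst {D : ℕ} {P : Pos D → Prop} (h : ∀ᵐ x, P x) : ∀ᵐ z : Pos D × Pos D, P z.1 :=
  Measure.quasiMeasurePreserving_fst.ae h

lemma ae_snd {D : ℕ} {P : Pos D → Prop} (h : ∀ᵐ x, P x) : ∀ᵐ z : Pos D × Pos D, P z.2 :=
  Measure.quasiMeasurePreserving_snd.ae h

/-- The bilinear map `(f, g) ↦ f ⊗ g`. -/
def tmul {D : ℕ} : ModeSpace D →L[ℂ] ModeSpace D →L[ℂ] PairSpace D :=
  LinearMap.mkContinuous₂
    (LinearMap.mk₂ ℂ tvec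
      (by
        intro f f' g
        ext1
        filter_upwards [coeFn_tvec (f + f') g, coeFn_tvec f g, coeFn_tvec f' g,
          Lp.coeFn_add (tvec f g) (tvec f' g), ae_fst (Lp.coeFn_add f f')] with z h1 h2 h3 h4 h5
        rw [h1, h4, Pi.add_apply, h2, h3, h5, Pi.add_apply, add_mul])
      (by
        intro c f g
        ext1
        filter_upwards [coeFn_tvec (c • f) g, coeFn_tvec f g,
          Lp.coeFn_smul c (tvec f g), ae_fst (Lp.coeFn_smul c f)] with z h1 h2 h4 h5
        rw [h1, h4, Pi.smul_apply, h2, h5, Pi.smul_apply, smul_eq_mul, smul_eq_mul, mul_assoc])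
      (by
        intro f g g'
        ext1
        filter_upwards [coeFn_tvec f (g + g'), coeFn_tvec f g, coeFn_tvec f g',
          Lp.coeFn_add (tvec f g) (tvec f g'), ae_snd (Lp.coeFn_add g g')] with z h1 h2 h3 h4 h5
        rw [h1, h4, Pi.add_apply, h2, h3, h5, Pi.add_apply, mul_add])
      (by
        intro c f g
        ext1
        filter_upwards [coeFn_tvec f (c • g), coeFn_tvec f g,
          Lp.coeFn_smul c (tvec f g), ae_snd (Lp.coeFn_smul c g)] with z h1 h2 h4 h5
        rw [h1, h4, Pi.smul_apply, h2, h5, Pi.smul_apply, smul_eq_mul, smul_eq_mul]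
        ring))
    1 (fun f g => by rw [LinearMap.mk₂_apply, norm_tvec, one_mul])

lemma tmul_apply {D : ℕ} (f g : ModeSpace D) : tmul f g = tvec f g := rfl

/-- For isometries with mutually orthogonal ranges there is a bounded operator that acts as a
given bounded operator on each of the ranges. -/
lemma exists_ampliation {ι H K : Type*} [NormedAddCommGroup H] [InnerProductSpace ℂ H]
    [CompleteSpace H] [NormedAddCommGroup K] [InnerProductSpace ℂ K] [CompleteSpace K]
    (V : ι → H →ₗᵢ[ℂ] K) (hV : OrthogonalFamily ℂ (fun _ : ι => H) V) (A : H →L[ℂ] H) :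
    ∃ T : K →L[ℂ] K, ∀ i f, T (V i f) = V i (A f) := by
  classical
  let W : ι → K →L[ℂ] H := fun i => ContinuousLinearMap.adjoint (V i).toContinuousLinearMap
  have hW : ∀ i f ψ, ⟪V i f, ψ⟫_ℂ = ⟪f, W i ψ⟫_ℂ := fun i f ψ =>
    (ContinuousLinearMap.adjoint_inner_right (V i).toContinuousLinearMap f ψ).symm
  have hWV : ∀ i j f, W i (V j f) = if i = j then f else 0 := by
    intro i j f
    refine ext_inner_left ℂ fun g => ?_
    rw [← hW]
    split_ifs with h
    · subst h; exact (V i).inner_map_map g f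
    · rw [inner_zero_right]; exact hV h g f
  have hB : ∀ (s : Finset ι) (ψ : K), ∑ i ∈ s, ‖W i ψ‖ ^ 2 ≤ ‖ψ‖ ^ 2 := by
    intro s ψ
    have h1 : ‖∑ i ∈ s, V i (W i ψ)‖ ^ 2 = ∑ i ∈ s, ‖W i ψ‖ ^ 2 := hV.norm_sum (fun i => W i ψ) s
    have h2 : ⟪∑ i ∈ s, V i (W i ψ), ψ⟫_ℂ = ((∑ i ∈ s, ‖W i ψ‖ ^ 2 : ℝ) : ℂ) := by
      rw [sum_inner]
      push_cast
      exact Finset.sum_congr rfl fun i _ => by rw [hW, inner_self_eq_norm_sq_to_K]; rfl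
    have h3 := norm_inner_le_norm (𝕜 := ℂ) (∑ i ∈ s, V i (W i ψ)) ψ
    rw [h2, Complex.norm_real, Real.norm_of_nonneg (Finset.sum_nonneg fun i _ => sq_nonneg _),
      ← h1] at h3
    rw [← h1]
    nlinarith [norm_nonneg (∑ i ∈ s, V i (W i ψ)), norm_nonneg ψ]
  have hA : ∀ (s : Finset ι) (ψ : K), ∑ i ∈ s, ‖A (W i ψ)‖ ^ 2 ≤ (‖A‖ * ‖ψ‖) ^ 2 := by
    intro s ψ
    calc ∑ i ∈ s, ‖A (W i ψ)‖ ^ 2 ≤ ∑ i ∈ s, ‖A‖ ^ 2 * ‖W i ψ‖ ^ 2 :=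
          Finset.sum_le_sum fun i _ => by
            rw [← mul_pow]; exact pow_le_pow_left₀ (norm_nonneg _) (A.le_opNorm _) 2
      _ = ‖A‖ ^ 2 * ∑ i ∈ s, ‖W i ψ‖ ^ 2 := by rw [Finset.mul_sum]
      _ ≤ ‖A‖ ^ 2 * ‖ψ‖ ^ 2 := mul_le_mul_of_nonneg_left (hB s ψ) (sq_nonneg _)
      _ = (‖A‖ * ‖ψ‖) ^ 2 := by rw [mul_pow]
  have hsum : ∀ ψ : K, Summable fun i => V i (A (W i ψ)) := fun ψ =>
    (hV.summable_iff_norm_sq_summable fun i => A (W i ψ)).2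
      (summable_of_sum_le (fun i => sq_nonneg _) fun s => hA s ψ)
  let T : K →ₗ[ℂ] K :=
    { toFun := fun ψ => ∑' i, V i (A (W i ψ))
      map_add' := by
        intro x y
        rw [← (hsum x).tsum_add (hsum y)]
        simp
      map_smul' := by
        intro c x
        rw [RingHom.id_apply, ← (hsum x).tsum_const_smul c]
        simp }
  refine ⟨T.mkContinuous ‖A‖ fun ψ => ?_, fun i f => ?_⟩
  · refine le_of_tendsto ((hsum ψ).hasSum.norm) (Filter.Eventually.of_forall fun s => ?_)
    refine le_of_sq_le_sq ?_ (by positivity)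
    have h1 : ‖∑ i ∈ s, V i (A (W i ψ))‖ ^ 2 = ∑ i ∈ s, ‖A (W i ψ)‖ ^ 2 :=
      hV.norm_sum (fun i => A (W i ψ)) s
    rw [h1]
    exact hA s ψ
  · change ∑' j, V j (A (W j (V i f))) = _
    rw [tsum_eq_single i fun j hj => by rw [hWV, if_neg hj, map_zero, map_zero], hWV, if_pos rfl]

/-- Tensor products of operators exist for a bilinear map that multiplies inner products. -/
lemma exists_tensorOp_aux {H K : Type*} [NormedAddCommGroup H] [InnerProductSpace ℂ H]
    [CompleteSpace H] [NormedAddCommGroup K] [InnerProductSpace ℂ K] [CompleteSpace K]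
    (t : H →L[ℂ] H →L[ℂ] K)
    (ht : ∀ f g f' g', ⟪t f g, t f' g'⟫_ℂ = ⟪f, f'⟫_ℂ * ⟪g, g'⟫_ℂ)
    (hn : ∀ f g, ‖t f g‖ = ‖f‖ * ‖g‖) (A B : H →L[ℂ] H) :
    ∃ T : K →L[ℂ] K, ∀ f g, T (t f g) = t (A f) (B g) := by
  have hb := (basis H).orthonormal
  have hb1 : ∀ i, ‖basis H i‖ = 1 := hb.1
  let V : BasisIdx H → H →ₗᵢ[ℂ] K := fun i =>
    ⟨(t.flip (basis H i)).toLinearMap, fun f => by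
      change ‖t f (basis H i)‖ = _
      rw [hn, hb1, mul_one]⟩
  let V' : BasisIdx H → H →ₗᵢ[ℂ] K := fun i =>
    ⟨(t (basis H i)).toLinearMap, fun f => by
      change ‖t (basis H i) f‖ = _
      rw [hn, hb1, one_mul]⟩
  obtain ⟨S, hS⟩ := exists_ampliation V (by
    intro i j hij f g
    change ⟪t f (basis H i), t g (basis H j)⟫_ℂ = 0
    rw [ht, hb.2 hij, mul_zero]) A
  obtain ⟨S', hS'⟩ := exists_ampliation V' (by
    intro i j hij f g
    change ⟪t (basis H i) f, t (basis H j) g⟫_ℂ = 0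
    rw [ht, hb.2 hij, zero_mul]) B
  have key : ∀ (F G : H →L[ℂ] K), (∀ i, F (basis H i) = G (basis H i)) → F = G := by
    intro F G h
    refine ContinuousLinearMap.ext_on (s := Set.range (basis H)) ?_ ?_
    · rw [Submodule.dense_iff_topologicalClosure_eq_top]
      exact (basis H).dense_span
    · rintro _ ⟨i, rfl⟩
      exact h i
  have h1 : ∀ f g, S (t f g) = t (A f) g := fun f g =>
    DFunLike.congr_fun (key (S ∘L t f) (t (A f)) fun i => hS i f) g
  have h2 : ∀ f g, S' (t f g) = t f (B g) := fun f g =>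
    DFunLike.congr_fun (key (S' ∘L t.flip g) (t.flip (B g)) fun i => hS' i g) f
  exact ⟨S ∘L S', fun f g => by rw [ContinuousLinearMap.comp_apply, h2, h1]⟩

/-- Existence of the tensor product of two bounded operators. -/
theorem exists_tensorOp {D : ℕ} (A B : ModeSpace D →L[ℂ] ModeSpace D) :
    ∃ T : PairSpace D →L[ℂ] PairSpace D, ∀ f g, T (tmul f g) = tmul (A f) (B g) :=
  exists_tensorOp_aux tmul inner_tvec norm_tvec A B

/-- The tensor product `A ⊗ B`: the bounded operator with `(A ⊗ B)(f ⊗ g) = A f ⊗ B g`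
(unique, as product vectors span a dense subspace). -/
def tensorOp {D : ℕ} (A B : ModeSpace D →L[ℂ] ModeSpace D) : PairSpace D →L[ℂ] PairSpace D :=
  (exists_tensorOp A B).choose

/-- The partial trace over the second system, `Tr_Y T = ∑ₖ (1 ⊗ ⟨eₖ|) T (1 ⊗ |eₖ⟩)`; for
trace-class `T` the series converges in norm and does not depend on the orthonormal basis. -/
def partialTrace {D : ℕ} (T : PairSpace D →L[ℂ] PairSpace D) : ModeSpace D →L[ℂ] ModeSpace D :=
  ∑' k : BasisIdx (ModeSpace D),
    ContinuousLinearMap.adjoint (tmul.flip (basis (ModeSpace D) k)) ∘L T ∘L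
      (tmul.flip (basis (ModeSpace D) k))

/-! ### The beam splitter -/

/-- The rotation `(x, y) ↦ (√τ x - √(1-τ) y, √(1-τ) x + √τ y)`. -/
def rot {D : ℕ} (τ : ℝ) (z : Pos D × Pos D) : Pos D × Pos D :=
  (√τ • z.1 - √(1 - τ) • z.2, √(1 - τ) • z.1 + √τ • z.2)

lemma measurePreserving_rot {D : ℕ} {τ : ℝ} (hτ : τ ∈ Set.Ioo (0 : ℝ) 1) :
    MeasurePreserving (rot (D := D) τ) volume volume := by
  have h1 : √τ * √τ = τ := Real.mul_self_sqrt hτ.1.le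
  have h2 : √(1 - τ) * √(1 - τ) = 1 - τ := Real.mul_self_sqrt (by linarith [hτ.2])
  have h3 : √τ * √τ + √(1 - τ) * √(1 - τ) = 1 := by rw [h1, h2]; ring
  let e : WithLp 2 (Pos D × Pos D) ≃ₗ[ℝ] WithLp 2 (Pos D × Pos D) :=
    { toFun := fun z => WithLp.toLp 2 (rot τ z.ofLp)
      invFun := fun z => WithLp.toLp 2
        (√τ • z.ofLp.1 + √(1 - τ) • z.ofLp.2, -(√(1 - τ) • z.ofLp.1) + √τ • z.ofLp.2)
      map_add' := by
        intro x y
        refine WithLp.ofLp_injective 2 (Prod.ext ?_ ?_)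
        all_goals ext i
        all_goals simp [rot]
        all_goals ring
      map_smul' := by
        intro c x
        refine WithLp.ofLp_injective 2 (Prod.ext ?_ ?_)
        all_goals ext i
        all_goals simp [rot]
        all_goals ring
      left_inv := by
        intro z
        refine WithLp.ofLp_injective 2 (Prod.ext ?_ ?_)
        all_goals ext i
        · simp [rot]; linear_combination (z.fst i) * h3
        · simp [rot]; linear_combination (z.snd i) * h3
      right_inv := by
        intro z
        refine WithLp.ofLp_injective 2 (Prod.ext ?_ ?_)
        all_goals ext i
        · simp [rot]; linear_combination (z.fst i) * h3
        · simp [rot]; linear_combination (z.snd i) * h3 }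
  let e' : WithLp 2 (Pos D × Pos D) ≃ₗᵢ[ℝ] WithLp 2 (Pos D × Pos D) :=
    ⟨e, by
      intro z
      rw [← pow_left_inj₀ (norm_nonneg _) (norm_nonneg _) two_ne_zero,
        WithLp.prod_norm_sq_eq_of_L2, WithLp.prod_norm_sq_eq_of_L2]
      change ‖√τ • z.fst - √(1 - τ) • z.snd‖ ^ 2 + ‖√(1 - τ) • z.fst + √τ • z.snd‖ ^ 2 = _
      rw [norm_sub_sq_real, norm_add_sq_real]
      simp only [norm_smul, real_inner_smul_left, real_inner_smul_right, mul_pow, Real.norm_eq_abs,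
        sq_abs]
      linear_combination (‖z.fst‖ ^ 2 + ‖z.snd‖ ^ 2) * h3⟩
  exact ((WithLp.volume_preserving_ofLp (Pos D) (Pos D)).comp e'.measurePreserving).comp
    (WithLp.volume_preserving_toLp (Pos D) (Pos D))

/-- The beam-splitter unitary of transmissivity `τ`,
`(U Ψ)(x, y) = Ψ(√τ x - √(1-τ) y, √(1-τ) x + √τ y)`. In the Heisenberg picture
`U† â_X U = √τ â_X + √(1-τ) â_Y`, mode by mode. -/
def beamSplitter {D : ℕ} (τ : ℝ) (hτ : τ ∈ Set.Ioo (0 : ℝ) 1) :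
    PairSpace D →L[ℂ] PairSpace D :=
  (Lp.compMeasurePreservingₗᵢ ℂ (rot τ) (measurePreserving_rot hτ)).toContinuousLinearMap

/-- The quantum convolution `ρ_X ⊞_τ ρ_Y = Tr_Y [U_τ (ρ_X ⊗ ρ_Y) U_τ†]`. -/
def qconv {D : ℕ} (τ : ℝ) (hτ : τ ∈ Set.Ioo (0 : ℝ) 1)
    (ρX ρY : ModeSpace D →L[ℂ] ModeSpace D) : ModeSpace D →L[ℂ] ModeSpace D :=
  partialTrace (beamSplitter τ hτ ∘L tensorOp ρX ρY ∘L
    ContinuousLinearMap.adjoint (beamSplitter τ hτ))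

/-! ### Quasi-probability distributions and Rényi entropies -/

/-- The `s`-ordered characteristic function `χ(η) exp(s |η|² / 2)`; in the present units the
vacuum has `χ(η) = exp(-|η|² / 2)`. -/
def charFnOrd {D : ℕ} (s : ℝ) (ρ : ModeSpace D →L[ℂ] ModeSpace D) (η : Phase D) : ℂ :=
  charFn ρ η * Complex.exp ((s * ‖η‖ ^ 2 / 2 : ℝ) : ℂ)

/-- The Fourier integral
`(2π)^{-2D} ∫ exp(-i xᵀ Γ η) χ(η) exp(s |η|² / 2) dη`. -/
def quasiInt {D : ℕ} (s : ℝ) (ρ : ModeSpace D →L[ℂ] ModeSpace D) (x : Phase D) : ℂ :=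
  (((2 * Real.pi) ^ (2 * D) : ℝ) : ℂ)⁻¹ *
    ∫ η : Phase D, Complex.exp (-Complex.I * ((symp x η : ℝ) : ℂ)) * charFnOrd s ρ η

/-- The `s`-ordered quasi-probability distribution of `ρ`: the Wigner function for `s = 0`, the
Husimi function for `s = -1`, the Glauber–Sudarshan function for `s = 1`. -/
def quasiDist {D : ℕ} (s : ℝ) (ρ : ModeSpace D →L[ℂ] ModeSpace D) (x : Phase D) : ℝ :=
  (quasiInt s ρ x).re

/-- The quantum Rényi-`p` entropy `S_p(ρ) = (1 - p)⁻¹ log ∫ q^p` of the `s`-ordered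
quasi-probability distribution `q` of `ρ`. -/
def renyiEntropy {D : ℕ} (s p : ℝ) (ρ : ModeSpace D →L[ℂ] ModeSpace D) : ℝ :=
  1 / (1 - p) * Real.log (∫ x : Phase D, quasiDist s ρ x ^ p)

/-- The quantum Rényi-`p` entropy power `V_p(ρ) = exp(S_p(ρ) / D)`. -/
def entropyPower {D : ℕ} (s p : ℝ) (ρ : ModeSpace D →L[ℂ] ModeSpace D) : ℝ :=
  Real.exp (1 / (D : ℝ) * renyiEntropy s p ρ)

/-- The `s`-ordered quasi-probability distribution of `ρ` is a genuine nonnegative function and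
its Rényi-`p` entropy is well defined. -/
def HasRenyiEntropy {D : ℕ} (s p : ℝ) (ρ : ModeSpace D →L[ℂ] ModeSpace D) : Prop :=
  Integrable (charFnOrd s ρ) ∧
    (∀ x, (quasiInt s ρ x).im = 0 ∧ 0 ≤ quasiDist s ρ x) ∧
    Integrable (fun x => quasiDist s ρ x ^ p) ∧
    0 < ∫ x : Phase D, quasiDist s ρ x ^ p

end Bosonic

end

/-! For Gaussian states the inequality is Minkowski's determinant inequality. The beam splitter acts
on characteristic functions by χ_Z(η) = χ_X(√τ η) χ_Y(√(1-τ) η) (`isDensityOperator_qconv`), so the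
covariance matrices satisfy V_Z = τ V_X + (1-τ) V_Y. The s-ordered function has quadratic form A =
ΓᵀVΓ - s (`ordCov`), which is affine in V, so A_Z is the same convex combination of A_X and A_Y.
When A is positive definite, the quasi-probability distribution is a genuine Gaussian and its
entropy power is a constant depending on D and p times (det A)^(1/2D) (`entropyPower_gaussian`).
Concavity of this root of the determinant (`rpow_det_convex_comb_le`) gives the inequality with κ =
1, and superadditivity of t ↦ t^κ for κ ≥ 1 gives the rest.

Two points need operator theory. The first is the product formula. Writing ρ = R² with R
Hilbert–Schmidt turns every trace into an absolutely convergent sum, and in the Heisenberg picture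
D(η) ⊗ 1 pulls back through the rotation to D(√τ η) ⊗ D(√(1-τ) η).

The second is that A is positive definite. For s > 0 this follows from integrability
(`posDef_of_integrable_exp`). For s ≤ 0 it suffices that |χ(η)| < 1 for η ≠ 0: if |χ(η)| = 1, the
state is supported on an eigenspace of D(η), and every Weyl operator anticommuting with D(η) then
has zero expectation, whereas a Gaussian χ never vanishes (`norm_trace_comp_ne_one`). -/

set_option linter.unusedSectionVars false

noncomputable section

namespace Bosonic

/-! ### Hilbert–Schmidt operators and traces -/

section HilbertSchmidt

variable {H K : Type*} [NormedAddCommGroup H] [InnerProductSpace ℂ H] [CompleteSpace H]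
  [NormedAddCommGroup K] [InnerProductSpace ℂ K] [CompleteSpace K] {ι κ : Type*}

lemma hasSum_of_eq {α M : Type*} [AddCommMonoid M] [TopologicalSpace M] {f g : α → M} {a : M}
    (hf : HasSum f a) (h : ∀ x, f x = g x) : HasSum g a :=
  (funext h : f = g) ▸ hf

/-- Parseval's identity. -/
lemma hasSum_norm_inner_sq (b : HilbertBasis ι ℂ H) (x : H) :
    HasSum (fun i => ‖⟪x, b i⟫_ℂ‖ ^ 2) (‖x‖ ^ 2) := by
  have h := Complex.hasSum_re (b.hasSum_inner_mul_inner x x)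
  rw [inner_self_eq_norm_sq_to_K] at h
  convert h using 1
  · ext i
    rw [← inner_conj_symm (b i) x, Complex.mul_conj, Complex.normSq_eq_norm_sq, Complex.ofReal_re]
  · norm_cast

lemma hasSum_norm_inner_sq' (b : HilbertBasis ι ℂ H) (x : H) :
    HasSum (fun i => ‖⟪b i, x⟫_ℂ‖ ^ 2) (‖x‖ ^ 2) := by
  simpa only [norm_inner_symm] using hasSum_norm_inner_sq b x

lemma summable_matrix_coeff (b : HilbertBasis ι ℂ H) (b' : HilbertBasis κ ℂ K)
    {X : H →L[ℂ] K} (hX : Summable fun i => ‖X (b i)‖ ^ 2) :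
    Summable fun q : ι × κ => ‖⟪X (b q.1), b' q.2⟫_ℂ‖ ^ 2 := by
  refine (summable_prod_of_nonneg fun q => sq_nonneg _).2 ⟨fun i => ?_, ?_⟩
  · exact (hasSum_norm_inner_sq b' (X (b i))).summable
  · simpa only [(hasSum_norm_inner_sq b' _).tsum_eq] using hX

/-- The adjoint of a Hilbert–Schmidt operator is Hilbert–Schmidt. -/
lemma summable_norm_adjoint_sq (b : HilbertBasis ι ℂ H) (b' : HilbertBasis κ ℂ K)
    {X : H →L[ℂ] K} (hX : Summable fun i => ‖X (b i)‖ ^ 2) :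
    Summable fun j => ‖ContinuousLinearMap.adjoint X (b' j)‖ ^ 2 := by
  have h := (summable_matrix_coeff b b' hX).prod_symm.prod
  refine h.congr fun j => ?_
  rw [← (hasSum_norm_inner_sq' b _).tsum_eq]
  exact tsum_congr fun i => by rw [ContinuousLinearMap.adjoint_inner_right]; rfl

/-- The Hilbert–Schmidt inner product does not depend on the basis. -/
lemma hasSum_inner_adjoint (b : HilbertBasis ι ℂ H) (b' : HilbertBasis κ ℂ K)
    {X Y : H →L[ℂ] K} (hX : Summable fun i => ‖X (b i)‖ ^ 2)
    (hY : Summable fun i => ‖Y (b i)‖ ^ 2) {a : ℂ} (ha : HasSum (fun i => ⟪X (b i), Y (b i)⟫_ℂ) a) :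
    HasSum (fun j => ⟪ContinuousLinearMap.adjoint Y (b' j),
      ContinuousLinearMap.adjoint X (b' j)⟫_ℂ) a := by
  -- Absolute summability of the double family of matrix coefficients allows summing over either
  -- index first.
  have hs : Summable fun q : ι × κ => ⟪X (b q.1), b' q.2⟫_ℂ * ⟪b' q.2, Y (b q.1)⟫_ℂ := by
    refine Summable.of_norm_bounded
      ((summable_matrix_coeff b b' hX).add (summable_matrix_coeff b b' hY)) fun q => ?_
    rw [norm_mul, norm_inner_symm (b' q.2)]
    nlinarith [sq_nonneg (‖⟪X (b q.1), b' q.2⟫_ℂ‖ - ‖⟪Y (b q.1), b' q.2⟫_ℂ‖),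
      sq_nonneg ‖⟪X (b q.1), b' q.2⟫_ℂ‖, sq_nonneg ‖⟪Y (b q.1), b' q.2⟫_ℂ‖]
  obtain ⟨c, hc⟩ := hs
  have h1 := hc.prod_fiberwise fun i => b'.hasSum_inner_mul_inner (X (b i)) (Y (b i))
  obtain rfl := ha.unique h1
  refine ((Equiv.prodComm κ ι).hasSum_iff.2 hc).prod_fiberwise fun j => ?_
  refine hasSum_of_eq (b.hasSum_inner_mul_inner
    (ContinuousLinearMap.adjoint Y (b' j)) (ContinuousLinearMap.adjoint X (b' j))) fun i => ?_
  rw [ContinuousLinearMap.adjoint_inner_right, ContinuousLinearMap.adjoint_inner_left, mul_comm]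
  rfl

lemma summable_inner_of_summable_norm_sq {f g : ι → H} (hf : Summable fun i => ‖f i‖ ^ 2)
    (hg : Summable fun i => ‖g i‖ ^ 2) : Summable fun i => ⟪f i, g i⟫_ℂ := by
  refine Summable.of_norm_bounded (hf.add hg) fun i => ?_
  nlinarith [norm_inner_le_norm (𝕜 := ℂ) (f i) (g i), sq_nonneg (‖f i‖ - ‖g i‖),
    sq_nonneg ‖f i‖, sq_nonneg ‖g i‖]

lemma summable_norm_comp_left (b : HilbertBasis ι ℂ H) {L : Type*} [NormedAddCommGroup L]
    [InnerProductSpace ℂ L] (B : K →L[ℂ] L) {X : H →L[ℂ] K}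
    (hX : Summable fun i => ‖X (b i)‖ ^ 2) : Summable fun i => ‖B (X (b i))‖ ^ 2 := by
  refine Summable.of_nonneg_of_le (fun i => sq_nonneg _) (fun i => ?_) (hX.mul_left (‖B‖ ^ 2))
  rw [← mul_pow]
  exact pow_le_pow_left₀ (norm_nonneg _) (B.le_opNorm _) 2

/-- The operator norm is at most the Hilbert–Schmidt norm. -/
lemma norm_sq_le_tsum (b : HilbertBasis ι ℂ H) {X : H →L[ℂ] K}
    (hX : Summable fun i => ‖X (b i)‖ ^ 2) : ‖X‖ ^ 2 ≤ ∑' i, ‖X (b i)‖ ^ 2 := by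
  have h0 : 0 ≤ ∑' i, ‖X (b i)‖ ^ 2 := tsum_nonneg fun i => sq_nonneg _
  -- For the adjoint, Parseval gives ‖X† g‖² = ∑ |⟨X bᵢ, g⟩|², to which Cauchy–Schwarz applies term
  -- by term.
  rw [← LinearIsometryEquiv.norm_map ContinuousLinearMap.adjoint X]
  have : ‖ContinuousLinearMap.adjoint X‖ ≤ √(∑' i, ‖X (b i)‖ ^ 2) := by
    refine ContinuousLinearMap.opNorm_le_bound _ (Real.sqrt_nonneg _) fun g => ?_
    refine le_of_sq_le_sq ?_ (by positivity)
    rw [mul_pow, Real.sq_sqrt h0, ← (hasSum_norm_inner_sq' b _).tsum_eq, ← tsum_mul_right]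
    refine Summable.tsum_le_tsum (fun i => ?_) (hasSum_norm_inner_sq' b _).summable
      (hX.mul_right _)
    rw [ContinuousLinearMap.adjoint_inner_right, ← mul_pow]
    exact pow_le_pow_left₀ (norm_nonneg _) (norm_inner_le_norm _ _) 2
  calc _ ≤ √(∑' i, ‖X (b i)‖ ^ 2) ^ 2 := pow_le_pow_left₀ (norm_nonneg _) this 2
    _ = _ := Real.sq_sqrt h0

/-- `Tr (K K† B) = ∑ⱼ ⟨K eⱼ, B K eⱼ⟩` for Hilbert–Schmidt `K`. -/
lemma hasSum_inner_comp (b : HilbertBasis ι ℂ H) (b' : HilbertBasis κ ℂ K) {X : H →L[ℂ] K}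
    (hX : Summable fun i => ‖X (b i)‖ ^ 2) (B : K →L[ℂ] K) :
    ∃ a, HasSum (fun i => ⟪X (b i), B (X (b i))⟫_ℂ) a ∧
      HasSum (fun j => ⟪ContinuousLinearMap.adjoint X (b' j),
        ContinuousLinearMap.adjoint X (B (b' j))⟫_ℂ) a := by
  have hX' := summable_norm_comp_left b (ContinuousLinearMap.adjoint B) hX
  obtain ⟨a, ha⟩ := summable_inner_of_summable_norm_sq hX' hX
  refine ⟨a, ?_, ?_⟩
  · simpa only [ContinuousLinearMap.adjoint_inner_left] using ha
  · have := hasSum_inner_adjoint b b' (X := ContinuousLinearMap.adjoint B ∘L X) (Y := X)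
      (by simpa using hX') hX (by simpa using ha)
    simpa [ContinuousLinearMap.adjoint_comp] using this

/-- A density operator is the square of a self-adjoint operator of Hilbert–Schmidt norm one. -/
lemma IsDensityOperator.exists_sqrt {ρ : H →L[ℂ] H} (hρ : IsDensityOperator ρ) :
    ∃ R : H →L[ℂ] H, ContinuousLinearMap.adjoint R = R ∧ R ∘L R = ρ ∧
      HasSum (fun i => ‖R (basis H i)‖ ^ 2) 1 := by
  have h0 : 0 ≤ ρ := (ContinuousLinearMap.nonneg_iff_isPositive ρ).2 hρ.1
  have hR : 0 ≤ CFC.sqrt ρ := CFC.sqrt_nonneg ρ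
  have hRa : ContinuousLinearMap.adjoint (CFC.sqrt ρ) = CFC.sqrt ρ :=
    ((ContinuousLinearMap.nonneg_iff_isPositive _).1 hR).isSelfAdjoint
  have hRR : CFC.sqrt ρ ∘L CFC.sqrt ρ = ρ := CFC.sqrt_mul_sqrt_self ρ h0
  refine ⟨CFC.sqrt ρ, hRa, hRR, ?_⟩
  -- A divergent `tsum` has the value 0, so trace one forces convergence.
  have hs : Summable fun i : BasisIdx H => ⟪basis H i, ρ (basis H i)⟫_ℂ := by
    by_contra h
    have := hρ.2
    rw [trace, tsum_eq_zero_of_not_summable h] at this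
    exact zero_ne_one this
  have h1 := hs.hasSum
  rw [show ∑' i, ⟪basis H i, ρ (basis H i)⟫_ℂ = 1 from hρ.2] at h1
  have h2 := Complex.hasSum_re h1
  rw [Complex.one_re] at h2
  convert h2 using 1
  ext i
  nth_rw 2 [← hRR]
  rw [ContinuousLinearMap.comp_apply, ← ContinuousLinearMap.adjoint_inner_left, hRa,
    inner_self_eq_norm_sq_to_K]
  norm_cast

/-- Cyclicity of the trace, the case X = R of `hasSum_inner_comp`. It expresses Tr(ρB) through
expectations of B in the vectors R eᵢ. -/
lemma hasSum_trace_comp {R : H →L[ℂ] H} (hRa : ContinuousLinearMap.adjoint R = R)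
    (hR : Summable fun i => ‖R (basis H i)‖ ^ 2) (B : H →L[ℂ] H) :
    HasSum (fun i => ⟪R (basis H i), B (R (basis H i))⟫_ℂ) (trace ((R ∘L R) ∘L B)) := by
  obtain ⟨a, h1, h2⟩ := hasSum_inner_comp (basis H) (basis H) hR B
  convert h1
  rw [trace, ← h2.tsum_eq]
  exact tsum_congr fun i => by
    rw [ContinuousLinearMap.adjoint_inner_left, hRa]; rfl

end HilbertSchmidt

/-! ### Product vectors -/

lemma inner_tvec_indicator {D : ℕ} {A B : Set (Pos D)} (hA : MeasurableSet A)
    (hB : MeasurableSet B) (hA' : volume A ≠ ∞) (hB' : volume B ≠ ∞) (F : PairSpace D) :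
    ⟪tvec (indicatorConstLp 2 hA hA' (1 : ℂ)) (indicatorConstLp 2 hB hB' (1 : ℂ)), F⟫_ℂ =
      ∫ z in A ×ˢ B, F z := by
  rw [L2.inner_def, ← integral_indicator (hA.prod hB)]
  refine integral_congr_ae ?_
  filter_upwards [coeFn_tvec (indicatorConstLp 2 hA hA' (1 : ℂ)) (indicatorConstLp 2 hB hB' 1),
    ae_fst (indicatorConstLp_coeFn (p := 2) (hs := hA) (hμs := hA') (c := (1 : ℂ))),
    ae_snd (indicatorConstLp_coeFn (p := 2) (hs := hB) (hμs := hB') (c := (1 : ℂ)))] with z h1 h2 h3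
  rw [h1, h2, h3]
  by_cases ha : z.1 ∈ A <;> by_cases hb : z.2 ∈ B <;> simp [ha, hb, Set.indicator]

/-- A square-integrable function whose integrals over all rectangles contained in a given rectangle
vanish is zero almost everywhere on that rectangle. -/
lemma ae_restrict_eq_zero_of_inner_tvec {D : ℕ} (F : PairSpace D)
    (h : ∀ f g : ModeSpace D, ⟪tvec f g, F⟫_ℂ = 0) {A B : Set (Pos D)} (hA : MeasurableSet A)
    (hB : MeasurableSet B) (hA' : volume A ≠ ∞) (hB' : volume B ≠ ∞) :
    ∀ᵐ z ∂(volume.restrict (A ×ˢ B)), F z = 0 := by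
  have hrect : ∀ s t, MeasurableSet s → MeasurableSet t →
      ∫ z in s ×ˢ t, F z ∂(volume.restrict (A ×ˢ B)) = 0 := by
    intro s t hs ht
    rw [Measure.restrict_restrict (hs.prod ht), Set.prod_inter_prod,
      ← inner_tvec_indicator (hs.inter hA) (ht.inter hB) (measure_inter_ne_top_of_right_ne_top hA')
        (measure_inter_ne_top_of_right_ne_top hB')]
    exact h _ _
  -- On a rectangle of finite measure F is integrable, and rectangles form a π-system generating the
  -- product σ-algebra, so all its set integrals there vanish.
  have hfin : IsFiniteMeasure ((volume : Measure (Pos D × Pos D)).restrict (A ×ˢ B)) := by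
    refine ⟨?_⟩
    rw [Measure.restrict_apply_univ, Measure.volume_eq_prod, Measure.prod_prod]
    exact ENNReal.mul_lt_top hA'.lt_top hB'.lt_top
  have hint : Integrable F (volume.restrict (A ×ˢ B)) :=
    ((Lp.memLp F).restrict _).integrable one_le_two
  refine hint.ae_eq_zero_of_forall_setIntegral_eq_zero fun s hs _ => ?_
  induction s, hs using MeasurableSpace.induction_on_inter generateFrom_prod.symm isPiSystem_prod with
  | empty => simp
  | basic u hu =>
    obtain ⟨s, hs, t, ht, rfl⟩ := hu
    exact hrect s t hs ht
  | compl u hu ih =>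
    have h0 := hrect Set.univ Set.univ .univ .univ
    rw [Set.univ_prod_univ, Measure.restrict_univ] at h0
    rw [setIntegral_compl hu hint, ih (measure_lt_top _ _), h0, sub_zero]
  | iUnion f hd hf ih =>
    rw [integral_iUnion hf hd hint.integrableOn]
    simp [ih _ (measure_lt_top _ _)]

/-- Product vectors are total in `L²(ℝ^D × ℝ^D)`. -/
lemma eq_zero_of_inner_tvec {D : ℕ} (F : PairSpace D)
    (h : ∀ f g : ModeSpace D, ⟪tvec f g, F⟫_ℂ = 0) : F = 0 := by
  refine Lp.ext ?_
  refine Filter.EventuallyEq.trans ?_ (Lp.coeFn_zero ..).symm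
  have hU : (⋃ n : ℕ, Metric.closedBall (0 : Pos D) n ×ˢ Metric.closedBall (0 : Pos D) n) =
      Set.univ := by
    refine Set.eq_univ_of_forall fun z => ?_
    obtain ⟨n, hn⟩ := exists_nat_ge (max ‖z.1‖ ‖z.2‖)
    refine Set.mem_iUnion.2 ⟨n, ?_, ?_⟩
    · simpa using (le_max_left _ _).trans hn
    · simpa using (le_max_right _ _).trans hn
  have := (ae_restrict_iUnion_iff (μ := (volume : Measure (Pos D × Pos D)))
    (fun n : ℕ => Metric.closedBall (0 : Pos D) n ×ˢ Metric.closedBall (0 : Pos D) n)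
    (fun z => F z = 0)).2 fun n => ae_restrict_eq_zero_of_inner_tvec F h
      measurableSet_closedBall measurableSet_closedBall measure_closedBall_lt_top.ne
      measure_closedBall_lt_top.ne
  rwa [hU, Measure.restrict_univ] at this

lemma clm_ext_basis {H E : Type*} [NormedAddCommGroup H] [InnerProductSpace ℂ H]
    [NormedAddCommGroup E] [NormedSpace ℂ E] {ι : Type*}
    (b : HilbertBasis ι ℂ H) {F G : H →L[ℂ] E} (h : ∀ i, F (b i) = G (b i)) : F = G := by
  refine ContinuousLinearMap.ext_on (s := Set.range b) ?_ ?_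
  · rw [Submodule.dense_iff_topologicalClosure_eq_top]
    exact b.dense_span
  · rintro _ ⟨i, rfl⟩
    exact h i

lemma eq_zero_of_inner_tvec_basis {D : ℕ} (F : PairSpace D)
    (h : ∀ i j, ⟪F, tvec (basis (ModeSpace D) i) (basis (ModeSpace D) j)⟫_ℂ = 0) : F = 0 := by
  have h1 : ∀ f j, ⟪F, tvec f (basis (ModeSpace D) j)⟫_ℂ = 0 := fun f j =>
    DFunLike.congr_fun (clm_ext_basis (basis (ModeSpace D))
      (F := innerSL ℂ F ∘L tmul.flip (basis (ModeSpace D) j)) (G := 0) fun i => h i j) f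
  have h2 : ∀ f g, ⟪F, tvec f g⟫_ℂ = 0 := fun f g =>
    DFunLike.congr_fun (clm_ext_basis (basis (ModeSpace D))
      (F := innerSL ℂ F ∘L tmul f) (G := 0) fun j => h1 f j) g
  exact eq_zero_of_inner_tvec F fun f g => by rw [← inner_conj_symm, h2, map_zero]

/-- The product basis of `L²(ℝ^D × ℝ^D)`. -/
def pairBasis (D : ℕ) :
    HilbertBasis (BasisIdx (ModeSpace D) × BasisIdx (ModeSpace D)) ℂ (PairSpace D) :=
  HilbertBasis.mkOfOrthogonalEqBot
    (v := fun q => tvec (basis (ModeSpace D) q.1) (basis (ModeSpace D) q.2))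
    (by
      classical
      rw [orthonormal_iff_ite]
      rintro ⟨i, j⟩ ⟨i', j'⟩
      have hb := orthonormal_iff_ite.1 (basis (ModeSpace D)).orthonormal
      rw [inner_tvec, hb, hb]
      by_cases h1 : i = i' <;> by_cases h2 : j = j' <;> simp [h1, h2])
    (by
      rw [Submodule.eq_bot_iff]
      intro F hF
      refine eq_zero_of_inner_tvec_basis F fun i j => ?_
      exact (Submodule.mem_orthogonal' _ _).1 hF _ (Submodule.subset_span ⟨(i, j), rfl⟩))

lemma pairBasis_apply {D : ℕ} (q : BasisIdx (ModeSpace D) × BasisIdx (ModeSpace D)) :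
    pairBasis D q = tvec (basis (ModeSpace D) q.1) (basis (ModeSpace D) q.2) := by
  rw [pairBasis, HilbertBasis.coe_mkOfOrthogonalEqBot]

lemma clm_ext_tvec {D : ℕ} {E : Type*} [NormedAddCommGroup E] [NormedSpace ℂ E]
    {F G : PairSpace D →L[ℂ] E} (h : ∀ f g, F (tvec f g) = G (tvec f g)) : F = G :=
  clm_ext_basis (pairBasis D) fun q => by rw [pairBasis_apply]; exact h _ _

/-! ### Tensor products of operators -/

lemma tensorOp_tvec {D : ℕ} (A B : ModeSpace D →L[ℂ] ModeSpace D) (f g : ModeSpace D) :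
    tensorOp A B (tvec f g) = tvec (A f) (B g) :=
  (exists_tensorOp A B).choose_spec f g

lemma tensorOp_comp {D : ℕ} (A B A' B' : ModeSpace D →L[ℂ] ModeSpace D) :
    tensorOp A B ∘L tensorOp A' B' = tensorOp (A ∘L A') (B ∘L B') :=
  clm_ext_tvec fun f g => by simp [tensorOp_tvec]

/-- Both sides have the same inner products with product vectors, and these are total. -/
lemma adjoint_apply_of_total {H K : Type*} [NormedAddCommGroup H] [InnerProductSpace ℂ H]
    [CompleteSpace H] [NormedAddCommGroup K] [InnerProductSpace ℂ K] [CompleteSpace K]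
    {t : H →L[ℂ] H →L[ℂ] K}
    (ht : ∀ f g f' g', ⟪t f g, t f' g'⟫_ℂ = ⟪f, f'⟫_ℂ * ⟪g, g'⟫_ℂ)
    (htot : ∀ F : K, (∀ f g, ⟪t f g, F⟫_ℂ = 0) → F = 0) {A B : H →L[ℂ] H} {T : K →L[ℂ] K}
    (hT : ∀ f g, T (t f g) = t (A f) (B g)) (f g : H) :
    ContinuousLinearMap.adjoint T (t f g) =
      t (ContinuousLinearMap.adjoint A f) (ContinuousLinearMap.adjoint B g) := by
  rw [← sub_eq_zero]
  refine htot _ fun f' g' => ?_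
  rw [inner_sub_right, ContinuousLinearMap.adjoint_inner_right, hT, ht, ht,
    ContinuousLinearMap.adjoint_inner_right, ContinuousLinearMap.adjoint_inner_right, sub_self]

lemma adjoint_tensorOp {D : ℕ} (A B : ModeSpace D →L[ℂ] ModeSpace D) :
    ContinuousLinearMap.adjoint (tensorOp A B) =
      tensorOp (ContinuousLinearMap.adjoint A) (ContinuousLinearMap.adjoint B) := by
  refine clm_ext_tvec fun f g => ?_
  rw [tensorOp_tvec]
  exact adjoint_apply_of_total (t := tmul) inner_tvec eq_zero_of_inner_tvec
    (tensorOp_tvec A B) f g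

/-! ### Partial trace of `X X†` -/

section PartialTrace

variable {H K : Type*} [NormedAddCommGroup H] [InnerProductSpace ℂ H] [CompleteSpace H]
  [NormedAddCommGroup K] [InnerProductSpace ℂ K] [CompleteSpace K]
  (t : H →L[ℂ] H →L[ℂ] K)

/-- The partial trace over the second factor, relative to a bilinear map `(f, g) ↦ f ⊗ g`. -/
def ptrace (T : K →L[ℂ] K) : H →L[ℂ] H :=
  ∑' k : BasisIdx H, ContinuousLinearMap.adjoint (t.flip (basis H k)) ∘L T ∘L t.flip (basis H k)

variable {t} {e : HilbertBasis (BasisIdx H × BasisIdx H) ℂ K} {X : K →L[ℂ] K}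

/-- Each term is Yₖ†Yₖ with Yₖ = X†(· ⊗ eₖ). Its norm ‖Yₖ‖² is at most the squared Hilbert–Schmidt
norm ∑ᵢ ‖X†(eᵢ ⊗ eₖ)‖², and these add up over k to that of X†. Hence the series defining `ptrace`
converges in norm. -/
lemma summable_ptrace (he : ∀ q, e q = t (basis H q.1) (basis H q.2))
    (hX : Summable fun q => ‖X (e q)‖ ^ 2) :
    Summable fun k : BasisIdx H => ContinuousLinearMap.adjoint (t.flip (basis H k)) ∘L
        (X ∘L ContinuousLinearMap.adjoint X) ∘L t.flip (basis H k) := by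
  have hX' := summable_norm_adjoint_sq e e hX
  refine Summable.of_norm_bounded hX'.prod_symm.prod fun k => ?_
  have hk := hX'.prod_symm.prod_factor k
  set Y := ContinuousLinearMap.adjoint X ∘L t.flip (basis H k) with hY
  have h1 : ContinuousLinearMap.adjoint (t.flip (basis H k)) ∘L
      (X ∘L ContinuousLinearMap.adjoint X) ∘L t.flip (basis H k) =
      ContinuousLinearMap.adjoint Y ∘L Y := by
    rw [hY, ContinuousLinearMap.adjoint_comp, ContinuousLinearMap.adjoint_adjoint]
    rfl
  have h2 : ∀ i, Y (basis H i) = ContinuousLinearMap.adjoint X (e (i, k)) :=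
    fun i => by rw [he]; rfl
  rw [h1, ContinuousLinearMap.norm_adjoint_comp_self, ← sq]
  refine (norm_sq_le_tsum (basis H) (X := Y) ?_).trans_eq ?_
  · simp only [h2]
    exact hk
  · simp only [h2, Prod.swap_prod_mk]

lemma hasSum_inner_ptrace (he : ∀ q, e q = t (basis H q.1) (basis H q.2))
    (hX : Summable fun q => ‖X (e q)‖ ^ 2) (f g : H) :
    HasSum (fun k => ⟪ContinuousLinearMap.adjoint X (t f (basis H k)),
      ContinuousLinearMap.adjoint X (t g (basis H k))⟫_ℂ)
      ⟪f, ptrace t (X ∘L ContinuousLinearMap.adjoint X) g⟫_ℂ := by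
  have h := (summable_ptrace he hX).hasSum.mapL (innerSL ℂ f ∘L ContinuousLinearMap.apply ℂ H g)
  refine hasSum_of_eq h fun k => ?_
  change ⟪f, ContinuousLinearMap.adjoint (t.flip (basis H k)) (X
    (ContinuousLinearMap.adjoint X (t.flip (basis H k) g)))⟫_ℂ = _
  rw [ContinuousLinearMap.adjoint_inner_right, ← ContinuousLinearMap.adjoint_inner_left]
  rfl

/-- Diagonal matrix elements are sums of squares ‖X†(f ⊗ eₖ)‖². -/
lemma isPositive_ptrace (he : ∀ q, e q = t (basis H q.1) (basis H q.2))
    (hX : Summable fun q => ‖X (e q)‖ ^ 2) :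
    (ptrace t (X ∘L ContinuousLinearMap.adjoint X)).IsPositive := by
  refine (ContinuousLinearMap.isPositive_iff_complex _).2 fun f => ?_
  have h := hasSum_inner_ptrace he hX f f
  simp only [inner_self_eq_norm_sq_to_K] at h
  have h' := Complex.hasSum_re h
  have h2 := Complex.hasSum_im h
  norm_cast at h' h2
  have h3 := h2.unique hasSum_zero
  have h4 : ((⟪f, ptrace t (X ∘L ContinuousLinearMap.adjoint X) f⟫_ℂ).re : ℂ) =
      ⟪f, ptrace t (X ∘L ContinuousLinearMap.adjoint X) f⟫_ℂ :=
    Complex.ext (by simp) (by simp [h3])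
  rw [← inner_conj_symm, ← h4, Complex.conj_ofReal]
  exact ⟨by simp, by simpa using h'.nonneg fun k => sq_nonneg _⟩

/-- `Tr (Tr₂ (X X†) B) = Tr (X† (B ⊗ 1) X)`. -/
lemma hasSum_trace_ptrace (he : ∀ q, e q = t (basis H q.1) (basis H q.2))
    (hX : Summable fun q => ‖X (e q)‖ ^ 2) {B : H →L[ℂ] H}
    {B' : K →L[ℂ] K} (hB : ∀ f g, B' (t f g) = t (B f) g) :
    HasSum (fun q => ⟪X (e q), B' (X (e q))⟫_ℂ)
      (trace (ptrace t (X ∘L ContinuousLinearMap.adjoint X) ∘L B)) := by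
  obtain ⟨a, h1, h2⟩ := hasSum_inner_comp e e hX B'
  convert h1
  refine (h2.prod_fiberwise fun i => ?_).tsum_eq
  refine hasSum_of_eq (hasSum_inner_ptrace he hX (basis H i) (B (basis H i))) fun k => ?_
  rw [he, hB]

end PartialTrace

/-! ### Traces of product observables after an isometry -/

section Convolution

variable {H K : Type*} [NormedAddCommGroup H] [InnerProductSpace ℂ H] [CompleteSpace H]
  [NormedAddCommGroup K] [InnerProductSpace ℂ K] [CompleteSpace K]
  {t : H →L[ℂ] H →L[ℂ] K} {e : HilbertBasis (BasisIdx H × BasisIdx H) ℂ K}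
  {RX RY : H →L[ℂ] H} {X : K →L[ℂ] K} {U : K →ₗᵢ[ℂ] K}

lemma summable_norm_sq_tensor (hn : ∀ f g, ‖t f g‖ = ‖f‖ * ‖g‖)
    (he : ∀ q, e q = t (basis H q.1) (basis H q.2))
    (hX : ∀ f g, X (t f g) = U (t (RX f) (RY g)))
    (hRX : Summable fun i => ‖RX (basis H i)‖ ^ 2)
    (hRY : Summable fun i => ‖RY (basis H i)‖ ^ 2) : Summable fun q => ‖X (e q)‖ ^ 2 := by
  refine (hRX.mul_of_nonneg hRY (fun i => sq_nonneg _) fun i => sq_nonneg _).congr fun q => ?_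
  rw [he, hX, LinearIsometry.norm_map, hn, mul_pow]

lemma eq_mul_of_hasSum {ι κ : Type*} {f : ι → ℂ} {g : κ → ℂ} {a b c : ℂ} (hf : HasSum f a)
    (hg : HasSum g b) (h : HasSum (fun q : ι × κ => f q.1 * g q.2) c) : c = a * b :=
  h.unique (hf.mul hg h.summable)

/-- The trace against an observable `B` whose Heisenberg evolution factorises as `B₁ ⊗ B₂`. -/
lemma trace_ptrace_tensor
    (ht : ∀ f g f' g', ⟪t f g, t f' g'⟫_ℂ = ⟪f, f'⟫_ℂ * ⟪g, g'⟫_ℂ)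
    (hn : ∀ f g, ‖t f g‖ = ‖f‖ * ‖g‖)
    (he : ∀ q, e q = t (basis H q.1) (basis H q.2))
    (hX : ∀ f g, X (t f g) = U (t (RX f) (RY g)))
    (hRX : Summable fun i => ‖RX (basis H i)‖ ^ 2)
    (hRY : Summable fun i => ‖RY (basis H i)‖ ^ 2)
    (hRXa : ContinuousLinearMap.adjoint RX = RX) (hRYa : ContinuousLinearMap.adjoint RY = RY)
    {ρX ρY Z : H →L[ℂ] H} (hρX : RX ∘L RX = ρX) (hρY : RY ∘L RY = ρY)
    (hZ : Z = ptrace t (X ∘L ContinuousLinearMap.adjoint X))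
    {B B₁ B₂ : H →L[ℂ] H} {W : K →L[ℂ] K} (hW : ∀ f g, W (t f g) = t (B f) g)
    (hWU : ∀ f g, W (U (t f g)) = U (t (B₁ f) (B₂ g))) :
    trace (Z ∘L B) = trace (ρX ∘L B₁) * trace (ρY ∘L B₂) := by
  subst hρX hρY hZ
  have h := hasSum_trace_ptrace he (summable_norm_sq_tensor hn he hX hRX hRY) hW
  have h1 := hasSum_trace_comp hRXa hRX B₁
  have h2 := hasSum_trace_comp hRYa hRY B₂
  have h4 : ∀ q, ⟪X (e q), W (X (e q))⟫_ℂ = ⟪RX (basis H q.1), B₁ (RX (basis H q.1))⟫_ℂ *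
      ⟪RY (basis H q.2), B₂ (RY (basis H q.2))⟫_ℂ := fun q => by
    rw [he, hX, hWU, LinearIsometry.inner_map_map, ht]
  have h3 := hasSum_of_eq h h4
  exact eq_mul_of_hasSum h1 h2 h3

lemma conj_eq_comp_adjoint {U' S P : K →L[ℂ] K} (h : S ∘L ContinuousLinearMap.adjoint S = P) :
    U' ∘L P ∘L ContinuousLinearMap.adjoint U' =
      (U' ∘L S) ∘L ContinuousLinearMap.adjoint (U' ∘L S) := by
  rw [ContinuousLinearMap.adjoint_comp, ← h]
  rfl

end Convolution

/-! ### Weyl operators -/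

lemma coeFn_weyl {D : ℕ} (η : Phase D) (f : ModeSpace D) :
    weyl η f =ᵐ[volume] fun x => weylPhase η x * f (x - (2 : ℝ) • posPart η) :=
  (memLp_weyl η f).coeFn_toLp

lemma norm_weyl {D : ℕ} (η : Phase D) (f : ModeSpace D) : ‖weyl η f‖ = ‖f‖ := by
  change ‖(memLp_weyl η f).toLp _‖ = _
  rw [Lp.norm_toLp, Lp.norm_def]
  congr 1
  rw [← eLpNorm_comp_measurePreserving (Lp.memLp f).1 (measurePreserving_shift η)]
  exact eLpNorm_congr_norm_ae (Filter.Eventually.of_forall fun x => by simp [norm_weylPhase])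

lemma inner_weyl {D : ℕ} (η : Phase D) (f g : ModeSpace D) :
    ⟪weyl η f, weyl η g⟫_ℂ = ⟪f, g⟫_ℂ :=
  LinearIsometry.inner_map_map (⟨(weyl η).toLinearMap, norm_weyl η⟩ : ModeSpace D →ₗᵢ[ℂ] _) f g

lemma weyl_zero {D : ℕ} : weyl (0 : Phase D) = 1 := by
  ext1 f
  refine Lp.ext ?_
  filter_upwards [coeFn_weyl 0 f] with x hx
  rw [hx]
  have : posPart (0 : Phase D) = 0 := by ext j; simp [posPart]
  simp [weylPhase, this]

lemma charFn_zero {D : ℕ} (ρ : ModeSpace D →L[ℂ] ModeSpace D) : charFn ρ 0 = trace ρ := by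
  rw [charFn, weyl_zero]
  rfl

/-- Bounded operators `F ↦ m · (F ∘ φ)` on `L²`, with `m` unimodular and `φ` measure preserving. -/
lemma exists_mul_comp {α : Type*} [MeasurableSpace α] {μ : Measure α} {m : α → ℂ}
    (hm : AEStronglyMeasurable m μ) (hm1 : ∀ x, ‖m x‖ = 1) {φ : α → α}
    (hφ : MeasurePreserving φ μ μ) :
    ∃ W : Lp ℂ 2 μ →L[ℂ] Lp ℂ 2 μ, ∀ F, W F =ᵐ[μ] fun x => m x * F (φ x) := by
  have hmem : ∀ F : Lp ℂ 2 μ, MemLp (fun x => m x * F (φ x)) 2 μ := by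
    intro F
    have h := (Lp.memLp F).comp_measurePreserving hφ
    refine (memLp_congr_norm (hm.mul h.1) h.1 ?_).2 h
    exact Filter.Eventually.of_forall fun x => by simp [hm1]
  refine ⟨LinearMap.mkContinuous
    { toFun := fun F => (hmem F).toLp _
      map_add' := ?_
      map_smul' := ?_ } 1 ?_, fun F => (hmem F).coeFn_toLp⟩
  · intro F G
    ext1
    filter_upwards [(hmem (F + G)).coeFn_toLp, (hmem F).coeFn_toLp, (hmem G).coeFn_toLp,
      Lp.coeFn_add ((hmem F).toLp _) ((hmem G).toLp _),
      hφ.quasiMeasurePreserving.ae (Lp.coeFn_add F G)] with x h1 h2 h3 h4 h5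
    rw [h1, h4, Pi.add_apply, h2, h3, h5, Pi.add_apply, mul_add]
  · intro c F
    ext1
    filter_upwards [(hmem (c • F)).coeFn_toLp, (hmem F).coeFn_toLp,
      Lp.coeFn_smul c ((hmem F).toLp _),
      hφ.quasiMeasurePreserving.ae (Lp.coeFn_smul c F)] with x h1 h2 h4 h5
    simp only [RingHom.id_apply]
    rw [h1, h4, Pi.smul_apply, h2, h5, Pi.smul_apply, smul_eq_mul, smul_eq_mul]
    ring
  · intro F
    simp only [LinearMap.coe_mk, AddHom.coe_mk, one_mul, Lp.norm_toLp]
    rw [Lp.norm_def, ← eLpNorm_comp_measurePreserving (Lp.memLp F).1 hφ]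
    refine le_of_eq (congrArg _ (eLpNorm_congr_norm_ae (Filter.Eventually.of_forall fun x => ?_)))
    simp [hm1]

/-- The beam splitter as a linear isometry. -/
def beamIsometry {D : ℕ} (τ : ℝ) (hτ : τ ∈ Set.Ioo (0 : ℝ) 1) : PairSpace D →ₗᵢ[ℂ] PairSpace D :=
  Lp.compMeasurePreservingₗᵢ ℂ (rot τ) (measurePreserving_rot hτ)

lemma coeFn_beamIsometry {D : ℕ} (τ : ℝ) (hτ : τ ∈ Set.Ioo (0 : ℝ) 1) (F : PairSpace D) :
    beamIsometry τ hτ F =ᵐ[volume] fun z => F (rot τ z) :=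
  Lp.coeFn_compMeasurePreserving F (measurePreserving_rot hτ)

/-- The first coordinate is √τ times the first rotated coordinate plus √(1-τ) times the second, and
the shifts contribute the weights τ and 1-τ, which add up to 1. -/
lemma weylPhase_rot {D : ℕ} {τ : ℝ} (hτ : τ ∈ Set.Ioo (0 : ℝ) 1) (η : Phase D)
    (z : Pos D × Pos D) :
    weylPhase (√τ • η) (rot τ z).1 * weylPhase (√(1 - τ) • η) (rot τ z).2 = weylPhase η z.1 := by
  have h1 : √τ * √τ = τ := Real.mul_self_sqrt hτ.1.le
  have h2 : √(1 - τ) * √(1 - τ) = 1 - τ := Real.mul_self_sqrt (by linarith [hτ.2])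
  rw [weylPhase, weylPhase, weylPhase, ← Complex.exp_add, ← mul_add, ← Complex.ofReal_add,
    ← Finset.sum_add_distrib]
  congr 3
  refine Finset.sum_congr rfl fun j _ => ?_
  simp only [rot, PiLp.smul_apply, PiLp.sub_apply, PiLp.add_apply, smul_eq_mul]
  linear_combination (η (j, 1) * (z.1 j - η (j, 0))) * h1 + (η (j, 1) * (z.1 j - η (j, 0))) * h2

lemma rot_shift {D : ℕ} (τ : ℝ) (η : Phase D) (z : Pos D × Pos D) :
    rot τ (z.1 - (2 : ℝ) • posPart η, z.2) =
      ((rot τ z).1 - (2 : ℝ) • posPart (√τ • η), (rot τ z).2 - (2 : ℝ) • posPart (√(1 - τ) • η)) := by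
  refine Prod.ext ?_ ?_ <;> ext j <;> simp [rot, posPart] <;> ring

/-- The Weyl operator of the first output mode, in the Heisenberg picture. -/
lemma exists_weylFst {D : ℕ} {τ : ℝ} (hτ : τ ∈ Set.Ioo (0 : ℝ) 1) (η : Phase D) :
    ∃ W : PairSpace D →L[ℂ] PairSpace D, (∀ f g, W (tvec f g) = tvec (weyl η f) g) ∧
      ∀ f g, W (beamIsometry τ hτ (tvec f g)) =
        beamIsometry τ hτ (tvec (weyl (√τ • η) f) (weyl (√(1 - τ) • η) g)) := by
  have hφ : MeasurePreserving (fun z : Pos D × Pos D => (z.1 - (2 : ℝ) • posPart η, z.2))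
      volume volume := (measurePreserving_shift η).prod (MeasurePreserving.id _)
  -- W is D(η) ⊗ 1, realised as a phase and a shift in the first variable, so that its commutation
  -- with the rotation becomes a pointwise identity.
  obtain ⟨W, hW⟩ := exists_mul_comp (μ := (volume : Measure (Pos D × Pos D)))
    (m := fun z => weylPhase η z.1)
    ((continuous_weylPhase η).comp continuous_fst).aestronglyMeasurable
    (fun z => norm_weylPhase η z.1) hφ
  refine ⟨W, fun f g => ?_, fun f g => ?_⟩
  · refine Lp.ext ?_
    filter_upwards [hW (tvec f g), coeFn_tvec (weyl η f) g, ae_fst (coeFn_weyl η f),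
      hφ.quasiMeasurePreserving.ae (coeFn_tvec f g)] with z h1 h2 h3 h4
    rw [h1, h2, h3, h4, mul_assoc]
  · refine Lp.ext ?_
    have hr := (measurePreserving_rot (D := D) hτ).quasiMeasurePreserving
    filter_upwards [hW (beamIsometry τ hτ (tvec f g)),
      hφ.quasiMeasurePreserving.ae (coeFn_beamIsometry τ hτ (tvec f g)),
      hφ.quasiMeasurePreserving.ae (hr.ae (coeFn_tvec f g)),
      coeFn_beamIsometry τ hτ (tvec (weyl (√τ • η) f) (weyl (√(1 - τ) • η) g)),
      hr.ae (coeFn_tvec (weyl (√τ • η) f) (weyl (√(1 - τ) • η) g)),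
      hr.ae (ae_fst (coeFn_weyl (√τ • η) f)),
      hr.ae (ae_snd (coeFn_weyl (√(1 - τ) • η) g))] with z h1 h2 h3 h4 h5 h6 h7
    rw [h1, h2, h3, h4, h5, h6, h7, rot_shift, ← weylPhase_rot hτ]
    ring

/-! ### The quantum convolution -/

/-- The quantum convolution of density operators is a density operator whose characteristic function
is the product of rescaled characteristic functions. -/
theorem isDensityOperator_qconv {D : ℕ} {τ : ℝ} (hτ : τ ∈ Set.Ioo (0 : ℝ) 1)
    {ρX ρY : ModeSpace D →L[ℂ] ModeSpace D} (hX : IsDensityOperator ρX)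
    (hY : IsDensityOperator ρY) :
    IsDensityOperator (qconv τ hτ ρX ρY) ∧
      ∀ η, charFn (qconv τ hτ ρX ρY) η = charFn ρX (√τ • η) * charFn ρY (√(1 - τ) • η) := by
  obtain ⟨RX, hRXa, hRX, hRX1⟩ := hX.exists_sqrt
  obtain ⟨RY, hRYa, hRY, hRY1⟩ := hY.exists_sqrt
  -- With X = U(R_X ⊗ R_Y), the operator XX† is U(ρ_X ⊗ ρ_Y)U†, and X is Hilbert–Schmidt.
  let X : PairSpace D →L[ℂ] PairSpace D := beamSplitter τ hτ ∘L tensorOp RX RY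
  have hS : tensorOp RX RY ∘L ContinuousLinearMap.adjoint (tensorOp RX RY) = tensorOp ρX ρY := by
    rw [adjoint_tensorOp, tensorOp_comp, hRXa, hRYa, hRX, hRY]
  have hq : qconv τ hτ ρX ρY = ptrace tmul (X ∘L ContinuousLinearMap.adjoint X) :=
    congrArg (ptrace tmul) (conj_eq_comp_adjoint hS)
  have hXt : ∀ f g, X (tmul f g) = beamIsometry τ hτ (tmul (RX f) (RY g)) := fun f g => by
    exact congrArg (beamIsometry τ hτ) (tensorOp_tvec RX RY f g)
  have hchar : ∀ η, charFn (qconv τ hτ ρX ρY) η =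
      charFn ρX (√τ • η) * charFn ρY (√(1 - τ) • η) := by
    intro η
    obtain ⟨W, hW, hWU⟩ := exists_weylFst hτ η
    exact trace_ptrace_tensor (t := tmul) (e := pairBasis D) (B := weyl η)
      (B₁ := weyl (√τ • η)) (B₂ := weyl (√(1 - τ) • η)) inner_tvec norm_tvec pairBasis_apply hXt
      hRX1.summable hRY1.summable hRXa hRYa hRX hRY hq hW hWU
  refine ⟨⟨?_, ?_⟩, hchar⟩
  · rw [hq]
    exact isPositive_ptrace (t := tmul) (e := pairBasis D) pairBasis_apply
      (summable_norm_sq_tensor (t := tmul) (e := pairBasis D) norm_tvec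
        pairBasis_apply hXt hRX1.summable hRY1.summable)
  -- The trace is χ(0), and the product formula at η = 0 gives 1 · 1.
  · rw [← charFn_zero, hchar, smul_zero, smul_zero, charFn_zero, charFn_zero, hX.2, hY.2, mul_one]

/-! ### Strict positivity of Gaussian covariances -/

/-- The Weyl form of the canonical commutation relations. When the symplectic form equals π/2 the
phase is -1, so the two operators anticommute. -/
lemma weyl_comp_comm {D : ℕ} (η ξ : Phase D) (f : ModeSpace D) :
    weyl η (weyl ξ f) =
      Complex.exp (-2 * Complex.I * ((symp η ξ : ℝ) : ℂ)) • weyl ξ (weyl η f) := by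
  refine Lp.ext ?_
  filter_upwards [coeFn_weyl η (weyl ξ f), coeFn_weyl ξ (weyl η f), shift_ae η (coeFn_weyl ξ f),
    shift_ae ξ (coeFn_weyl η f), Lp.coeFn_smul
      (Complex.exp (-2 * Complex.I * ((symp η ξ : ℝ) : ℂ))) (weyl ξ (weyl η f))]
    with x h1 h2 h3 h4 h5
  rw [h5, Pi.smul_apply, h1, h2, h3, h4, smul_eq_mul, sub_right_comm, ← mul_assoc, ← mul_assoc,
    ← mul_assoc]
  congr 1
  simp only [weylPhase, ← Complex.exp_add]
  congr 1
  have : ∑ j, η (j, 1) * (x j - η (j, 0)) +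
      ∑ j, ξ (j, 1) * ((x - (2 : ℝ) • posPart η) j - ξ (j, 0)) =
      -2 * symp η ξ + ∑ j, ξ (j, 1) * (x j - ξ (j, 0)) +
      ∑ j, η (j, 1) * ((x - (2 : ℝ) • posPart ξ) j - η (j, 0)) := by
    simp only [symp, Finset.mul_sum, ← Finset.sum_add_distrib]
    refine Finset.sum_congr rfl fun j _ => ?_
    simp [posPart]
    ring
  have h' := congrArg (fun r : ℝ => Complex.I * (r : ℂ)) this
  simp only [Complex.ofReal_add, Complex.ofReal_mul, mul_add] at h'
  rw [h']
  push_cast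
  ring

/-- If c = Tr(ρW) had modulus one, equality in Cauchy–Schwarz would make every R eᵢ an eigenvector
of W with eigenvalue c. Since W' anticommutes with W, it sends such a vector into the eigenspace of
-c, which is orthogonal to it, so Tr(ρW') would vanish. -/
lemma norm_trace_comp_ne_one {H : Type*} [NormedAddCommGroup H] [InnerProductSpace ℂ H]
    [CompleteSpace H] {ρ W W' : H →L[ℂ] H} (hρ : IsDensityOperator ρ)
    (hWn : ∀ f, ‖W f‖ = ‖f‖) (hWi : ∀ f g, ⟪W f, W g⟫_ℂ = ⟪f, g⟫_ℂ)
    (hWW : ∀ f, W (W' f) = -W' (W f)) (hW' : trace (ρ ∘L W') ≠ 0) : ‖trace (ρ ∘L W)‖ ≠ 1 := by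
  intro h1
  obtain ⟨R, hRa, hR, hR1⟩ := hρ.exists_sqrt
  have hχ : ∀ B, HasSum (fun i => ⟪R (basis H i), B (R (basis H i))⟫_ℂ) (trace (ρ ∘L B)) :=
    fun B => hR ▸ hasSum_trace_comp hRa hR1.summable B
  set c := trace (ρ ∘L W)
  -- The total squared deviation from the eigenvalue equation is 1 - 2|c|² + 1 = 0.
  have hs : HasSum (fun i => ‖W (R (basis H i)) - c • R (basis H i)‖ ^ 2)
      (1 - 2 * (starRingEnd ℂ c * c).re + 1) := by
    refine hasSum_of_eq ((hR1.sub ((Complex.hasSum_re ((hχ W).mul_left (starRingEnd ℂ c))).mul_left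
      2)).add hR1) fun i => ?_
    rw [norm_sub_sq (𝕜 := ℂ), hWn, norm_smul, h1, one_mul, inner_smul_right,
      ← inner_conj_symm (W _), RCLike.re_eq_complex_re, ← Complex.conj_re (c * _), map_mul,
      Complex.conj_conj]
  have hc : (starRingEnd ℂ c * c).re = 1 := by
    rw [mul_comm, Complex.mul_conj, Complex.normSq_eq_norm_sq, h1]
    simp
  rw [hc, show (1 : ℝ) - 2 * 1 + 1 = 0 by norm_num,
    hasSum_zero_iff_of_nonneg fun i => sq_nonneg _] at hs
  have heig : ∀ i, W (R (basis H i)) = c • R (basis H i) := fun i => by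
    have := congrFun hs i
    simpa [sub_eq_zero] using this
  have hcc : starRingEnd ℂ c * c = 1 := by
    rw [mul_comm, Complex.mul_conj, Complex.normSq_eq_norm_sq, h1]
    simp
  refine hW' ((hχ W').unique (hasSum_of_eq hasSum_zero fun i => ?_))
  have h2 := hWi (R (basis H i)) (W' (R (basis H i)))
  rw [hWW, heig, map_smul, inner_neg_right, inner_smul_left, inner_smul_right, ← mul_assoc, hcc,
    one_mul] at h2
  linear_combination (1 / 2 : ℂ) * h2

lemma norm_charFn_ne_one {D : ℕ} {ρ : ModeSpace D →L[ℂ] ModeSpace D} (hρ : IsDensityOperator ρ)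
    {η ξ : Phase D} (hσ : symp η ξ = Real.pi / 2) (hξ : charFn ρ ξ ≠ 0) : ‖charFn ρ η‖ ≠ 1 := by
  refine norm_trace_comp_ne_one hρ (norm_weyl η) (inner_weyl η) (fun f => ?_) hξ
  rw [weyl_comp_comm, hσ, show -2 * Complex.I * ((Real.pi / 2 : ℝ) : ℂ) = -(Real.pi * Complex.I) by
    push_cast; ring, Complex.exp_neg, Complex.exp_pi_mul_I]
  norm_num

lemma norm_trace_comp_le_one {H : Type*} [NormedAddCommGroup H] [InnerProductSpace ℂ H]
    [CompleteSpace H] {ρ W : H →L[ℂ] H} (hρ : IsDensityOperator ρ)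
    (hWn : ∀ f, ‖W f‖ = ‖f‖) : ‖trace (ρ ∘L W)‖ ≤ 1 := by
  obtain ⟨R, hRa, hR, hR1⟩ := hρ.exists_sqrt
  have hχ : HasSum (fun i => ⟪R (basis H i), W (R (basis H i))⟫_ℂ) (trace (ρ ∘L W)) :=
    hR ▸ hasSum_trace_comp hRa hR1.summable W
  rw [← hχ.tsum_eq]
  refine tsum_of_norm_bounded hR1 fun i => ?_
  refine (norm_inner_le_norm _ _).trans_eq ?_
  rw [hWn, sq]

lemma norm_charFn_le_one {D : ℕ} {ρ : ModeSpace D →L[ℂ] ModeSpace D} (hρ : IsDensityOperator ρ)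
    (η : Phase D) : ‖charFn ρ η‖ ≤ 1 :=
  norm_trace_comp_le_one hρ (norm_weyl η)

/-! ### Linear changes of variables -/

section ChangeOfVariables

variable {E F : Type*} [NormedAddCommGroup E] [NormedSpace ℝ E] [MeasurableSpace E] [BorelSpace E]
  [FiniteDimensional ℝ E] (μ : Measure E) [μ.IsAddHaarMeasure] [NormedAddCommGroup F]

lemma measurableEmbedding_of_det_ne_zero {L : E →ₗ[ℝ] E} (hL : LinearMap.det L ≠ 0) :
    MeasurableEmbedding L :=
  (LinearMap.equivOfDetNeZero L hL).toContinuousLinearEquiv.toHomeomorph.measurableEmbedding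

lemma integrable_comp_linearMap_iff {L : E →ₗ[ℝ] E} (hL : LinearMap.det L ≠ 0) (g : E → F) :
    Integrable (fun x => g (L x)) μ ↔ Integrable g μ := by
  have h := (measurableEmbedding_of_det_ne_zero hL).integrable_map_iff (μ := μ) (g := g)
  rw [Measure.map_linearMap_addHaar_eq_smul_addHaar μ hL, integrable_smul_measure (by simpa using hL)
    ENNReal.ofReal_ne_top] at h
  exact h.symm

lemma integral_comp_linearMap [NormedSpace ℝ F] {L : E →ₗ[ℝ] E} (hL : LinearMap.det L ≠ 0)
    (g : E → F) : ∫ x, g (L x) ∂μ = |LinearMap.det L|⁻¹ • ∫ x, g x ∂μ := by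
  have h := (measurableEmbedding_of_det_ne_zero hL).integral_map (μ := μ) g
  rw [Measure.map_linearMap_addHaar_eq_smul_addHaar μ hL, integral_smul_measure,
    ENNReal.toReal_ofReal (abs_nonneg _), abs_inv] at h
  exact h.symm

end ChangeOfVariables

/-! ### Quadratic forms and Gaussian integrals -/

section Gaussian

open Matrix

variable {n : Type*} [Fintype n] [DecidableEq n]

/-- The quadratic form `xᵀ A x`. -/
def quadForm (A : Matrix n n ℝ) (x : EuclideanSpace ℝ n) : ℝ := x.ofLp ⬝ᵥ A *ᵥ x.ofLp

/-- A factor N makes the Gaussian with form A the pullback of the standard one by a linear map. Only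
|det N| enters the integrals. -/
lemma PosDef.exists_factor {A : Matrix n n ℝ} (hA : A.PosDef) :
    ∃ N : Matrix n n ℝ, Nᵀ * N = A ∧ N.det ≠ 0 ∧ |N.det| = √A.det := by
  open scoped MatrixOrder in
  obtain ⟨N, hN⟩ := CStarAlgebra.nonneg_iff_eq_star_mul_self.mp hA.posSemidef.nonneg
  rw [star_eq_conjTranspose, conjTranspose_eq_transpose_of_trivial] at hN
  have hd : A.det = N.det * N.det := by rw [hN, det_mul, det_transpose]
  refine ⟨N, hN.symm, fun h => ?_, ?_⟩
  · have := hA.det_pos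
    rw [hd, h, mul_zero] at this
    exact this.false
  · rw [hd, Real.sqrt_mul_self_eq_abs]

lemma ofLp_toEuclideanLin (N : Matrix n n ℝ) (x : EuclideanSpace ℝ n) :
    (toEuclideanLin N x).ofLp = N *ᵥ x.ofLp := rfl

lemma toEuclideanLin_transpose_inv {N : Matrix n n ℝ} (hN : N.det ≠ 0) (x : EuclideanSpace ℝ n) :
    toEuclideanLin Nᵀ (toEuclideanLin (Nᵀ)⁻¹ x) = x := by
  refine WithLp.ofLp_injective 2 ?_
  rw [ofLp_toEuclideanLin, ofLp_toEuclideanLin, mulVec_mulVec, mul_nonsing_inv, one_mulVec]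
  rw [det_transpose]
  exact isUnit_iff_ne_zero.2 hN

lemma norm_toEuclideanLin_sq (N : Matrix n n ℝ) (x : EuclideanSpace ℝ n) :
    ‖toEuclideanLin N x‖ ^ 2 = quadForm (Nᵀ * N) x := by
  rw [← real_inner_self_eq_norm_sq, EuclideanSpace.inner_eq_star_dotProduct, quadForm,
    ofLp_toEuclideanLin, star_trivial, ← mulVec_mulVec, dotProduct_mulVec x.ofLp,
    vecMul_transpose]

lemma inner_toEuclideanLin_transpose (N : Matrix n n ℝ) (x y : EuclideanSpace ℝ n) :
    ⟪toEuclideanLin Nᵀ x, y⟫_ℝ = ⟪x, toEuclideanLin N y⟫_ℝ := by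
  rw [EuclideanSpace.inner_eq_star_dotProduct, EuclideanSpace.inner_eq_star_dotProduct,
    ofLp_toEuclideanLin, ofLp_toEuclideanLin, star_trivial, star_trivial,
    dotProduct_mulVec, vecMul_transpose]

lemma det_toEuclideanLin (N : Matrix n n ℝ) : LinearMap.det (toEuclideanLin N) = N.det :=
  LinearMap.det_toLpLin ..

/-- A symmetric matrix whose Gaussian is integrable is positive definite: the Gaussian does not
decrease when stretched along an eigenvector with nonpositive eigenvalue. -/
lemma posDef_of_integrable_exp {A : Matrix n n ℝ} (hA : A.IsHermitian)
    (hint : Integrable fun x : EuclideanSpace ℝ n => Real.exp (-(1 / 2) * quadForm A x)) :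
    A.PosDef := by
  by_contra hn
  rw [hA.posDef_iff_eigenvalues_pos] at hn
  push Not at hn
  obtain ⟨i, hi⟩ := hn
  set w : n → ℝ := (hA.eigenvectorBasis i).ofLp with hw
  have hAw : A *ᵥ w = hA.eigenvalues i • w := hA.mulVec_eigenvectorBasis i
  have hww : w ⬝ᵥ w = 1 := by
    have h := real_inner_self_eq_norm_sq (hA.eigenvectorBasis i)
    rw [hA.eigenvectorBasis.orthonormal.1 i, EuclideanSpace.inner_eq_star_dotProduct,
      star_trivial] at h
    simpa using h
  -- S = 1 + wwᵀ doubles the component along the unit eigenvector w and fixes its orthogonal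
  -- complement, so it has determinant 2. It changes the form by 3λ(w·x)² ≤ 0, where λ is the
  -- eigenvalue of w. The integral of the stretched Gaussian is thus no smaller than the original,
  -- while the change of variables halves it.
  let S : Matrix n n ℝ := 1 + replicateCol Unit w * replicateRow Unit w
  have hS : S.det = 2 := by
    rw [det_one_add_replicateCol_mul_replicateRow, hww]; norm_num
  have hdet : LinearMap.det (toEuclideanLin S) = 2 := by rw [det_toEuclideanLin, hS]
  have hSx : ∀ x : n → ℝ, S *ᵥ x = x + (w ⬝ᵥ x) • w := by
    intro x
    rw [add_mulVec, one_mulVec]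
    congr 1
    ext j
    simp only [mulVec, dotProduct, mul_apply, replicateCol_apply, replicateRow_apply, Pi.smul_apply,
      smul_eq_mul, Finset.univ_unique, Finset.sum_const, Finset.card_singleton, one_smul,
      Finset.sum_mul]
    exact Finset.sum_congr rfl fun k _ => by ring
  have hq : ∀ x : EuclideanSpace ℝ n, quadForm A (toEuclideanLin S x) ≤ quadForm A x := by
    intro x
    have h1 : w ⬝ᵥ A *ᵥ x.ofLp = hA.eigenvalues i * (w ⬝ᵥ x.ofLp) := by
      rw [dotProduct_mulVec, ← mulVec_transpose, ← conjTranspose_eq_transpose_of_trivial, hA.eq,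
        hAw, smul_dotProduct, smul_eq_mul]
    rw [quadForm, quadForm, ofLp_toEuclideanLin, hSx, mulVec_add, mulVec_smul, hAw]
    simp only [add_dotProduct, dotProduct_add, smul_dotProduct, dotProduct_smul, smul_eq_mul, h1,
      hww, dotProduct_comm x.ofLp w]
    nlinarith [mul_nonneg (neg_nonneg.2 hi) (sq_nonneg (w ⬝ᵥ x.ofLp))]
  have h1 := integral_comp_linearMap volume (by rw [hdet]; norm_num)
    (fun x : EuclideanSpace ℝ n => Real.exp (-(1 / 2) * quadForm A x)) (L := toEuclideanLin S)
  have h2 : ∫ x : EuclideanSpace ℝ n, Real.exp (-(1 / 2) * quadForm A x) ≤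
      ∫ x : EuclideanSpace ℝ n, Real.exp (-(1 / 2) * quadForm A (toEuclideanLin S x)) := by
    refine integral_mono hint
      ((integrable_comp_linearMap_iff volume (by rw [hdet]; norm_num) _).2 hint) fun x => ?_
    exact Real.exp_le_exp.2 (by linarith [hq x])
  have h3 := integral_exp_pos hint
  rw [hdet, smul_eq_mul, abs_two] at h1
  linarith

/-- With the frequency written as Nᵀw, the integrand is a standard Gaussian with frequency w
evaluated at Nx, and no inverse of N appears. -/
lemma integrable_gaussian {N : Matrix n n ℝ} (hN : N.det ≠ 0) (w : EuclideanSpace ℝ n) :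
    Integrable fun x : EuclideanSpace ℝ n =>
      Complex.exp (-(1 / 2 : ℂ) * ((quadForm (Nᵀ * N) x : ℝ) : ℂ) +
        Complex.I * ((⟪toEuclideanLin Nᵀ w, x⟫_ℝ : ℝ) : ℂ)) := by
  have h := GaussianFourier.integrable_cexp_neg_mul_sq_norm_add (b := 1 / 2) (by norm_num)
    Complex.I w
  have hd : LinearMap.det (toEuclideanLin N) ≠ 0 := by rwa [det_toEuclideanLin]
  refine ((integrable_comp_linearMap_iff volume hd _).2 h).congr
    (Filter.Eventually.of_forall fun x => ?_)
  simp only [inner_toEuclideanLin_transpose, ← norm_toEuclideanLin_sq]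
  push_cast
  rfl

/-- The Fourier transform of a Gaussian with quadratic form `A = NᵀN`. -/
lemma integral_gaussian {N : Matrix n n ℝ} (hN : N.det ≠ 0) (w : EuclideanSpace ℝ n) :
    ∫ x : EuclideanSpace ℝ n,
      Complex.exp (-(1 / 2 : ℂ) * ((quadForm (Nᵀ * N) x : ℝ) : ℂ) +
        Complex.I * ((⟪toEuclideanLin Nᵀ w, x⟫_ℝ : ℝ) : ℂ)) =
      ((|N.det|⁻¹ * (2 * Real.pi) ^ ((Fintype.card n : ℝ) / 2) *
        Real.exp (-(1 / 2) * ‖w‖ ^ 2) : ℝ) : ℂ) := by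
  have h := GaussianFourier.integral_cexp_neg_mul_sq_norm_add (b := 1 / 2) (by norm_num)
    Complex.I w
  have hd : LinearMap.det (toEuclideanLin N) ≠ 0 := by rwa [det_toEuclideanLin]
  have h2 := integral_comp_linearMap volume hd (fun v : EuclideanSpace ℝ n =>
    Complex.exp (-(1 / 2) * (‖v‖ : ℂ) ^ 2 + Complex.I * ((⟪w, v⟫_ℝ : ℝ) : ℂ)))
  rw [h, det_toEuclideanLin] at h2
  have h3 : ∀ x : EuclideanSpace ℝ n,
      Complex.exp (-(1 / 2 : ℂ) * ((quadForm (Nᵀ * N) x : ℝ) : ℂ) +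
        Complex.I * ((⟪toEuclideanLin Nᵀ w, x⟫_ℝ : ℝ) : ℂ)) =
      Complex.exp (-(1 / 2) * (‖toEuclideanLin N x‖ : ℂ) ^ 2 +
        Complex.I * ((⟪w, toEuclideanLin N x⟫_ℝ : ℝ) : ℂ)) := fun x => by
    rw [inner_toEuclideanLin_transpose, ← norm_toEuclideanLin_sq]
    push_cast
    rfl
  simp only [h3]
  rw [h2, finrank_euclideanSpace]
  push_cast
  rw [Complex.real_smul, mul_assoc, Complex.ofReal_cpow (by positivity)]
  push_cast
  congr 3
  · ring
  · rw [Complex.I_sq]; ring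

lemma integral_gaussian_real (c : ℝ) (hc : 0 < c) :
    ∫ x : EuclideanSpace ℝ n, Real.exp (-c * ‖x‖ ^ 2) = (Real.pi / c) ^ ((Fintype.card n : ℝ) / 2) := by
  rw [GaussianFourier.integral_rexp_neg_mul_sq_norm hc, finrank_euclideanSpace]

end Gaussian

/-! ### Minkowski's determinant inequality -/

section Minkowski

open Matrix

variable {n : Type*} [Fintype n] [DecidableEq n] [Nonempty n]

/-- The AM–GM inequality is applied to the numbers 1/(1+μᵢ) and to μᵢ/(1+μᵢ). The two arithmetic
means add up to 1. -/
lemma one_add_prod_rpow_le {μ : n → ℝ} (hμ : ∀ i, 0 < μ i) :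
    1 + (∏ i, μ i) ^ (1 / (Fintype.card n : ℝ)) ≤
      (∏ i, (1 + μ i)) ^ (1 / (Fintype.card n : ℝ)) := by
  set r := 1 / (Fintype.card n : ℝ) with hr
  have hcard : (0 : ℝ) < Fintype.card n := by exact_mod_cast Fintype.card_pos
  have h1 : ∀ i, 0 < 1 + μ i := fun i => by linarith [hμ i]
  have hP : 0 < ∏ i, (1 + μ i) := Finset.prod_pos fun i _ => h1 i
  have amgm : ∀ z : n → ℝ, (∀ i, 0 < z i) → (∏ i, z i) ^ r ≤ ∑ i, r * z i := fun z hz => by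
    rw [← Real.finsetProd_rpow _ _ fun i _ => (hz i).le]
    refine Real.geom_mean_le_arith_mean_weighted _ (fun _ => r) z (fun i _ => by positivity) ?_
      fun i _ => (hz i).le
    rw [Finset.sum_const, Finset.card_univ, nsmul_eq_mul, hr]
    field_simp
  have ha := amgm (fun i => 1 / (1 + μ i)) fun i => by have := h1 i; positivity
  have hb := amgm (fun i => μ i / (1 + μ i)) fun i => div_pos (hμ i) (h1 i)
  have hab : ∑ i, r * (1 / (1 + μ i)) + ∑ i, r * (μ i / (1 + μ i)) = 1 := by
    rw [← Finset.sum_add_distrib]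
    have : ∀ i ∈ Finset.univ, r * (1 / (1 + μ i)) + r * (μ i / (1 + μ i)) = r := fun i _ => by
      have := (h1 i).ne'
      field_simp
    rw [Finset.sum_congr rfl this, Finset.sum_const, Finset.card_univ, nsmul_eq_mul, hr]
    field_simp
  rw [Finset.prod_div_distrib, Finset.prod_const_one, Real.div_rpow zero_le_one hP.le,
    Real.one_rpow] at ha
  rw [Finset.prod_div_distrib,
    Real.div_rpow (Finset.prod_nonneg fun i _ => (hμ i).le) hP.le] at hb
  have h := (add_le_add ha hb).trans_eq hab
  rwa [← add_div, div_le_one (Real.rpow_pos_of_pos hP _)] at h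

/-- The characteristic polynomial evaluated at -1, up to the sign (-1)ⁿ on both sides. -/
lemma det_one_add_eq_prod {C : Matrix n n ℝ} (hC : C.IsHermitian) :
    (1 + C).det = ∏ i, (1 + hC.eigenvalues i) := by
  have h := eval_charpoly C (-1)
  rw [hC.charpoly_eq, Polynomial.eval_prod, show scalar n (-1 : ℝ) - C = -(1 + C) by
    rw [map_neg, map_one]; abel, det_neg] at h
  have h2 : ∏ i, Polynomial.eval (-1) (Polynomial.X - Polynomial.C (hC.eigenvalues i : ℝ)) =
      (-1) ^ Fintype.card n * ∏ i, (1 + hC.eigenvalues i) := by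
    rw [← Finset.card_univ, ← Finset.prod_const, ← Finset.prod_mul_distrib]
    refine Finset.prod_congr rfl fun i _ => ?_
    simp
    ring
  exact mul_left_cancel₀ (pow_ne_zero _ (by norm_num)) (h.symm.trans h2)

/-- Minkowski's determinant inequality. -/
theorem rpow_det_add_le {A B : Matrix n n ℝ} (hA : A.PosDef) (hB : B.PosDef) :
    A.det ^ (1 / (Fintype.card n : ℝ)) + B.det ^ (1 / (Fintype.card n : ℝ)) ≤
      (A + B).det ^ (1 / (Fintype.card n : ℝ)) := by
  obtain ⟨N, hN, hNd, -⟩ := PosDef.exists_factor hA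
  have hu : IsUnit N.det := isUnit_iff_ne_zero.2 hNd
  -- The congruence by N⁻¹ turns A into 1 and B into C and divides all determinants by det A, which
  -- leaves an inequality in the eigenvalues of C.
  set C := (N⁻¹)ᵀ * B * N⁻¹ with hC
  have hCpd : C.PosDef := by
    have := hB.conjTranspose_mul_mul_same (B := N⁻¹) ?_
    · rwa [conjTranspose_eq_transpose_of_trivial] at this
    · rw [mulVec_injective_iff_isUnit]
      exact (isUnit_nonsing_inv_iff).2 ((isUnit_iff_isUnit_det N).2 hu)
  have hBC : B = Nᵀ * C * N := by
    rw [hC, mul_assoc, mul_assoc, mul_assoc, nonsing_inv_mul N hu, mul_one, ← mul_assoc,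
      ← transpose_mul, nonsing_inv_mul N hu, transpose_one, one_mul]
  have hd : A.det = N.det * N.det := by rw [← hN, det_mul, det_transpose]
  have hBd : B.det = A.det * C.det := by
    rw [hBC, hd, det_mul, det_mul, det_transpose]; ring
  have hABd : (A + B).det = A.det * (1 + C).det := by
    have : A + B = Nᵀ * (1 + C) * N := by
      rw [mul_add, add_mul, mul_one, hN, ← hBC]
    rw [this, hd, det_mul, det_mul, det_transpose]; ring
  have hCd : C.det = ∏ i, hCpd.1.eigenvalues i := hCpd.1.det_eq_prod_eigenvalues
  have hCp := hCpd.det_pos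
  have hC1 : 0 ≤ (1 + C).det := (PosDef.one.add hCpd).det_pos.le
  have h := one_add_prod_rpow_le hCpd.eigenvalues_pos
  rw [← hCd, ← det_one_add_eq_prod] at h
  rw [hBd, hABd, Real.mul_rpow hA.det_pos.le hCp.le, Real.mul_rpow hA.det_pos.le hC1]
  nlinarith [Real.rpow_nonneg hA.det_pos.le (1 / (Fintype.card n : ℝ))]

/-- Concavity of `A ↦ (det A)^(1/n)` on positive definite matrices. -/
theorem rpow_det_convex_comb_le {A B : Matrix n n ℝ} (hA : A.PosDef) (hB : B.PosDef) {a b : ℝ}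
    (ha : 0 < a) (hb : 0 < b) :
    a * A.det ^ (1 / (Fintype.card n : ℝ)) + b * B.det ^ (1 / (Fintype.card n : ℝ)) ≤
      (a • A + b • B).det ^ (1 / (Fintype.card n : ℝ)) := by
  -- The n-th root of the determinant is homogeneous of degree one, so superadditivity implies
  -- concavity.
  have key : ∀ (c : ℝ) (M : Matrix n n ℝ), 0 < c → M.PosDef →
      (c • M).det ^ (1 / (Fintype.card n : ℝ)) = c * M.det ^ (1 / (Fintype.card n : ℝ)) := by
    intro c M hc hM
    rw [det_smul, Real.mul_rpow (by positivity) hM.det_pos.le, ← Real.rpow_natCast,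
      ← Real.rpow_mul hc.le, mul_one_div_cancel (by simp), Real.rpow_one]
  rw [← key a A ha hA, ← key b B hb hB]
  exact rpow_det_add_le (hA.smul ha) (hB.smul hb)

end Minkowski

open Matrix

/-! ### Symplectic linear algebra -/

/-- The matrix `Γ` of the symplectic form. -/
def sympMatrix (D : ℕ) : Matrix (Fin D × Fin 2) (Fin D × Fin 2) ℝ :=
  of fun k l => if k.2 = 0 then (if l = (k.1, 1) then 1 else 0) else
    if l = (k.1, 0) then -1 else 0

lemma sympMatrix_mulVec {D : ℕ} (η : Phase D) : sympMatrix D *ᵥ η.ofLp = sympVec η := by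
  ext k
  simp only [mulVec, dotProduct, sympMatrix, sympVec, of_apply]
  split_ifs with h <;> simp

/-- The matrix `Γᵀ V Γ - s` of the quadratic form in the `s`-ordered characteristic function. -/
def ordCov {D : ℕ} (s : ℝ) (V : Matrix (Fin D × Fin 2) (Fin D × Fin 2) ℝ) :
    Matrix (Fin D × Fin 2) (Fin D × Fin 2) ℝ :=
  (sympMatrix D)ᵀ * V * sympMatrix D - s • 1

lemma quadForm_ordCov {D : ℕ} (s : ℝ) (V : Matrix (Fin D × Fin 2) (Fin D × Fin 2) ℝ)
    (η : Phase D) :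
    quadForm (ordCov s V) η = sympVec η ⬝ᵥ V *ᵥ sympVec η - s * ‖η‖ ^ 2 := by
  rw [quadForm, ordCov, sub_mulVec, dotProduct_sub, ← mulVec_mulVec, ← mulVec_mulVec,
    sympMatrix_mulVec, dotProduct_mulVec η.ofLp, vecMul_transpose, sympMatrix_mulVec,
    smul_mulVec, one_mulVec, dotProduct_smul, ← real_inner_self_eq_norm_sq,
    EuclideanSpace.inner_eq_star_dotProduct, star_trivial, smul_eq_mul]

lemma isHermitian_ordCov {D : ℕ} (s : ℝ) {V : Matrix (Fin D × Fin 2) (Fin D × Fin 2) ℝ}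
    (hV : V.IsSymm) : (ordCov s V).IsHermitian := by
  rw [IsHermitian, conjTranspose_eq_transpose_of_trivial, ordCov, transpose_sub, transpose_mul,
    transpose_mul, transpose_transpose, hV.eq, transpose_smul, transpose_one, mul_assoc]

/-- The orthogonal map `Γᵀ`, so that `xᵀ Γ η = ⟨Γᵀ x, η⟩`. -/
def sympAdj (D : ℕ) : Phase D ≃ₗᵢ[ℝ] Phase D where
  toFun x := WithLp.toLp 2 fun k => if k.2 = 0 then -x (k.1, 1) else x (k.1, 0)
  invFun x := WithLp.toLp 2 fun k => if k.2 = 0 then x (k.1, 1) else -x (k.1, 0)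
  map_add' x y := by
    ext k
    simp only [PiLp.add_apply]
    split_ifs <;> ring
  map_smul' c x := by
    ext k
    simp only [PiLp.smul_apply, smul_eq_mul, RingHom.id_apply]
    split_ifs <;> ring
  left_inv x := by
    ext ⟨j, a⟩
    fin_cases a <;> simp
  right_inv x := by
    ext ⟨j, a⟩
    fin_cases a <;> simp
  norm_map' x := by
    rw [← pow_left_inj₀ (norm_nonneg _) (norm_nonneg _) two_ne_zero, EuclideanSpace.norm_sq_eq,
      EuclideanSpace.norm_sq_eq, Fintype.sum_prod_type, Fintype.sum_prod_type]
    refine Finset.sum_congr rfl fun j _ => ?_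
    simp [Fin.sum_univ_two, add_comm]

lemma symp_eq_inner {D : ℕ} (x η : Phase D) : symp x η = ⟪sympAdj D x, η⟫_ℝ := by
  rw [PiLp.inner_apply, Fintype.sum_prod_type, symp]
  refine Finset.sum_congr rfl fun j _ => ?_
  simp [Fin.sum_univ_two, sympAdj]
  ring

/-! ### Gaussian states -/

section GaussianState

variable {D : ℕ} {ρ : ModeSpace D →L[ℂ] ModeSpace D} {d : Phase D}
  {V : Matrix (Fin D × Fin 2) (Fin D × Fin 2) ℝ}

/-- `χ` is the Gaussian with mean `d` and covariance matrix `V`. -/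
def HasGaussianCharFn (ρ : ModeSpace D →L[ℂ] ModeSpace D) (d : Phase D)
    (V : Matrix (Fin D × Fin 2) (Fin D × Fin 2) ℝ) : Prop :=
  ∀ η : Phase D, charFn ρ η =
    Complex.exp (-(1 / 2 : ℂ) * ((sympVec η ⬝ᵥ V.mulVec (sympVec η) : ℝ) : ℂ) +
      Complex.I * ((symp d η : ℝ) : ℂ))

lemma charFnOrd_eq (h : HasGaussianCharFn ρ d V) (s : ℝ) (η : Phase D) :
    charFnOrd s ρ η = Complex.exp (-(1 / 2 : ℂ) * ((quadForm (ordCov s V) η : ℝ) : ℂ) +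
      Complex.I * ((⟪sympAdj D d, η⟫_ℝ : ℝ) : ℂ)) := by
  rw [charFnOrd, h, ← Complex.exp_add, quadForm_ordCov, symp_eq_inner]
  congr 1
  push_cast
  ring

lemma norm_charFnOrd (h : HasGaussianCharFn ρ d V) (s : ℝ) (η : Phase D) :
    ‖charFnOrd s ρ η‖ = Real.exp (-(1 / 2) * quadForm (ordCov s V) η) := by
  rw [charFnOrd_eq h, Complex.norm_exp]
  congr 1
  simp

/-- The covariance matrix of a Gaussian state is strictly positive. -/
lemma quadForm_ordCov_zero_pos (hρ : IsDensityOperator ρ) (h : HasGaussianCharFn ρ d V)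
    {η : Phase D} (hη : η ≠ 0) : 0 < quadForm (ordCov 0 V) η := by
  have hn : ‖η‖ ≠ 0 := norm_ne_zero_iff.2 hη
  have h1 : charFnOrd 0 ρ η = charFn ρ η := by simp [charFnOrd]
  have h2 := norm_charFnOrd h 0 η
  rw [h1] at h2
  have h3 : ‖charFn ρ η‖ < 1 := by
    -- The vector ξ is Γᵀη rescaled so that its symplectic product with η is π/2, which makes the
    -- two Weyl operators anticommute.
    refine lt_of_le_of_ne (norm_charFn_le_one hρ η)
      (norm_charFn_ne_one hρ (ξ := (Real.pi / 2 / ‖η‖ ^ 2) • sympAdj D η) ?_ ?_)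
    · rw [symp_eq_inner, inner_smul_right, real_inner_self_eq_norm_sq, LinearIsometryEquiv.norm_map]
      field_simp
    · rw [h]
      exact Complex.exp_ne_zero _
  rw [h2, Real.exp_lt_one_iff] at h3
  linarith

/-- For s > 0 integrability excludes nonpositive eigenvalues. For s ≤ 0 the term -s|η|² is
nonnegative and is added to the strictly positive form of the case s = 0. -/
lemma posDef_ordCov (hρ : IsDensityOperator ρ) (h : HasGaussianCharFn ρ d V) (hV : V.IsSymm)
    {s : ℝ} (hs : 0 < s → Integrable (charFnOrd s ρ)) : (ordCov s V).PosDef := by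
  rcases lt_or_ge 0 s with h0 | h0
  · refine posDef_of_integrable_exp (isHermitian_ordCov s hV) ?_
    refine (hs h0).norm.congr (Filter.Eventually.of_forall fun η => ?_)
    exact norm_charFnOrd h s η
  · refine PosDef.of_dotProduct_mulVec_pos (isHermitian_ordCov s hV) fun x hx => ?_
    have hx' : (WithLp.toLp 2 x : Phase D) ≠ 0 := by simpa using hx
    have h1 := quadForm_ordCov_zero_pos hρ h hx'
    have h2 : 0 < quadForm (ordCov s V) (WithLp.toLp 2 x : Phase D) := by
      rw [quadForm_ordCov] at h1 ⊢
      nlinarith [sq_nonneg ‖(WithLp.toLp 2 x : Phase D)‖]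
    exact h2

/-- The constant in the entropy power of a Gaussian. -/
def entropyConst (D : ℕ) (p : ℝ) : ℝ :=
  Real.exp (1 / (D : ℝ) * (1 / (1 - p) *
    (D * Real.log (2 * Real.pi / p) - p * (D * Real.log (2 * Real.pi)))))

/-- The `s`-ordered distribution of a Gaussian state is a Gaussian. -/
lemma quasiInt_eq (h : HasGaussianCharFn ρ d V) {s : ℝ}
    {N : Matrix (Fin D × Fin 2) (Fin D × Fin 2) ℝ} (hN : Nᵀ * N = ordCov s V) (hd : N.det ≠ 0)
    (x : Phase D) :
    quasiInt s ρ x = ((((2 * Real.pi) ^ D * |N.det|)⁻¹ *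
      Real.exp (-(1 / 2) * ‖toEuclideanLin (Nᵀ)⁻¹ (sympAdj D (d - x))‖ ^ 2) : ℝ) : ℂ) := by
  have hI := integral_gaussian hd (toEuclideanLin (Nᵀ)⁻¹ (sympAdj D (d - x)))
  rw [toEuclideanLin_transpose_inv hd, hN] at hI
  have h1 : ∀ η : Phase D, Complex.exp (-Complex.I * ((symp x η : ℝ) : ℂ)) * charFnOrd s ρ η =
      Complex.exp (-(1 / 2 : ℂ) * ((quadForm (ordCov s V) η : ℝ) : ℂ) +
        Complex.I * ((⟪sympAdj D (d - x), η⟫_ℝ : ℝ) : ℂ)) := fun η => by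
    rw [charFnOrd_eq h, ← Complex.exp_add, symp_eq_inner, map_sub, inner_sub_left]
    congr 1
    push_cast
    ring
  simp only [quasiInt, h1]
  rw [hI, ← Complex.ofReal_inv, ← Complex.ofReal_mul]
  congr 1
  have hc : ((Fintype.card (Fin D × Fin 2) : ℕ) : ℝ) / 2 = (D : ℝ) := by
    rw [Fintype.card_prod, Fintype.card_fin, Fintype.card_fin]
    push_cast
    ring
  rw [hc, Real.rpow_natCast, mul_comm 2 D, pow_mul]
  have : (2 * Real.pi) ^ D ≠ 0 := by positivity
  have : |N.det| ≠ 0 := abs_ne_zero.2 hd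
  field_simp

/-- The Rényi entropy power of a Gaussian state in terms of its covariance matrix. -/
theorem entropyPower_gaussian (hD : 0 < D) (h : HasGaussianCharFn ρ d V) {s p : ℝ} (hp : 1 < p)
    (hA : (ordCov s V).PosDef) :
    HasRenyiEntropy s p ρ ∧ entropyPower s p ρ = entropyConst D p *
      (ordCov s V).det ^ (1 / (Fintype.card (Fin D × Fin 2) : ℝ)) := by
  obtain ⟨N, hN, hd, hdet⟩ := PosDef.exists_factor hA
  have hp0 : 0 < p := by linarith
  have hNd : 0 < |N.det| := abs_pos.2 hd
  set c : ℝ := ((2 * Real.pi) ^ D * |N.det|)⁻¹ with hc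
  have hc0 : 0 < c := by positivity
  have hq : ∀ x, quasiDist s ρ x =
      c * Real.exp (-(1 / 2) * ‖toEuclideanLin (Nᵀ)⁻¹ (sympAdj D (d - x))‖ ^ 2) := fun x => by
    rw [quasiDist, quasiInt_eq h hN hd, Complex.ofReal_re]
  have hqp : ∀ x, quasiDist s ρ x ^ p =
      c ^ p * Real.exp (-(p / 2) * ‖toEuclideanLin (Nᵀ)⁻¹ (sympAdj D (d - x))‖ ^ 2) := fun x => by
    rw [hq, Real.mul_rpow hc0.le (Real.exp_nonneg _), ← Real.exp_mul]
    ring_nf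
  have hLdet : LinearMap.det (toEuclideanLin (Nᵀ)⁻¹) = (N.det)⁻¹ := by
    rw [det_toEuclideanLin, det_nonsing_inv, det_transpose, Ring.inverse_eq_inv']
  have hL0 : LinearMap.det (toEuclideanLin (Nᵀ)⁻¹) ≠ 0 := by rw [hLdet]; exact inv_ne_zero hd
  let g : Phase D → ℝ := fun y => Real.exp (-(p / 2) * ‖y‖ ^ 2)
  have hg : Integrable g := by
    have := (GaussianFourier.integrable_cexp_neg_mul_sq_norm_add (V := Phase D)
      (b := ((p / 2 : ℝ) : ℂ)) (by rw [Complex.ofReal_re]; positivity) 0 0).norm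
    refine this.congr (Filter.Eventually.of_forall fun y => ?_)
    simp only [zero_mul, add_zero, Complex.norm_exp, g]
    congr 1
    norm_cast
  have hg1 := (integrable_comp_linearMap_iff volume hL0 g).2 hg
  have hg2 := (sympAdj D).measurePreserving.integrable_comp_of_integrable hg1
  have hg3 := hg2.comp_sub_left d
  have hI : ∫ x, quasiDist s ρ x ^ p = c ^ p * (|N.det| * (2 * Real.pi / p) ^ D) := by
    simp only [hqp]
    rw [integral_const_mul]
    congr 1
    -- The reflected translation x ↦ d - x and the isometry Γᵀ preserve volume. The map (Nᵀ)⁻¹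
    -- contributes the factor |det N|.
    have e1 := integral_sub_left_eq_self
      (fun x => g (toEuclideanLin (Nᵀ)⁻¹ (sympAdj D x))) volume d
    have e2 := (sympAdj D).measurePreserving.integral_comp
      (sympAdj D).toHomeomorph.measurableEmbedding (fun x => g (toEuclideanLin (Nᵀ)⁻¹ x))
    have e3 := integral_comp_linearMap volume hL0 g
    have e4 := integral_gaussian_real (n := Fin D × Fin 2) (p / 2) (by positivity)
    refine e1.trans (e2.trans (e3.trans ?_))
    rw [hLdet, abs_inv, inv_inv, smul_eq_mul]
    congr 1
    refine e4.trans ?_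
    have hcard : ((Fintype.card (Fin D × Fin 2) : ℕ) : ℝ) / 2 = (D : ℝ) := by
      rw [Fintype.card_prod, Fintype.card_fin, Fintype.card_fin]
      push_cast
      ring
    rw [hcard, Real.rpow_natCast]
    congr 1
    field_simp
  have hIpos : 0 < ∫ x, quasiDist s ρ x ^ p := by rw [hI]; positivity
  refine ⟨⟨?_, fun x => ⟨?_, ?_⟩, ?_, hIpos⟩, ?_⟩
  · have hi := integrable_gaussian hd (toEuclideanLin (Nᵀ)⁻¹ (sympAdj D d))
    rw [toEuclideanLin_transpose_inv hd, hN] at hi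
    exact hi.congr (Filter.Eventually.of_forall fun η => (charFnOrd_eq h s η).symm)
  · rw [quasiInt_eq h hN hd, Complex.ofReal_im]
  · rw [hq]; positivity
  · simp only [hqp]
    exact hg3.const_mul _
  -- The integral depends on N through |det N|^(1-p). The factor 1/(1-p) cancels the exponent, and
  -- |det N|^(1/D) is the 2D-th root of det A because |det N| = √(det A).
  · rw [entropyPower, renyiEntropy, hI, entropyConst, Real.rpow_def_of_pos hA.det_pos,
      ← Real.exp_add]
    congr 1
    have hlog : Real.log |N.det| = Real.log (ordCov s V).det / 2 := by
      rw [hdet, Real.log_sqrt hA.det_pos.le]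
    rw [Real.log_mul (by positivity) (by positivity), Real.log_rpow hc0,
      Real.log_mul hNd.ne' (by positivity), Real.log_pow, hc, Real.log_inv,
      Real.log_mul (by positivity) hNd.ne', Real.log_pow, hlog, Fintype.card_prod, Fintype.card_fin,
      Fintype.card_fin]
    have : (1 : ℝ) - p ≠ 0 := by linarith
    have : (D : ℝ) ≠ 0 := by exact_mod_cast hD.ne'
    push_cast
    field_simp
    ring

end GaussianState

/-! ### The convolution of Gaussian states -/

/-- Rescaling by √τ multiplies the quadratic part of the exponent by τ and the linear part by √τ,
and similarly for 1-τ. The exponents then add. -/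
lemma HasGaussianCharFn.qconv {D : ℕ} {τ : ℝ} (hτ : τ ∈ Set.Ioo (0 : ℝ) 1)
    {ρX ρY : ModeSpace D →L[ℂ] ModeSpace D} (hρX : IsDensityOperator ρX)
    (hρY : IsDensityOperator ρY) {dX dY : Phase D}
    {VX VY : Matrix (Fin D × Fin 2) (Fin D × Fin 2) ℝ} (hX : HasGaussianCharFn ρX dX VX)
    (hY : HasGaussianCharFn ρY dY VY) :
    HasGaussianCharFn (qconv τ hτ ρX ρY) (√τ • dX + √(1 - τ) • dY) (τ • VX + (1 - τ) • VY) := by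
  intro η
  have h1 : √τ * √τ = τ := Real.mul_self_sqrt hτ.1.le
  have h2 : √(1 - τ) * √(1 - τ) = 1 - τ := Real.mul_self_sqrt (by linarith [hτ.2])
  have hv : ∀ c : ℝ, sympVec (c • η) = c • sympVec η := fun c => by
    rw [← sympMatrix_mulVec, ← sympMatrix_mulVec, WithLp.ofLp_smul, mulVec_smul]
  rw [(isDensityOperator_qconv hτ hρX hρY).2, hX, hY, ← Complex.exp_add, hv, hv]
  simp only [symp_eq_inner, map_add, map_smul, inner_add_left, inner_smul_left, inner_smul_right,
    mulVec_smul, smul_dotProduct, dotProduct_smul, add_mulVec, smul_mulVec, dotProduct_add,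
    smul_eq_mul, conj_trivial, ← mul_assoc, h1, h2]
  congr 1
  push_cast
  ring

/-- The shift by s survives because the weights add up to one. -/
lemma ordCov_convex_comb {D : ℕ} (s τ : ℝ) (VX VY : Matrix (Fin D × Fin 2) (Fin D × Fin 2) ℝ) :
    ordCov s (τ • VX + (1 - τ) • VY) = τ • ordCov s VX + (1 - τ) • ordCov s VY := by
  simp only [ordCov, mul_add, add_mul, Matrix.mul_smul, Matrix.smul_mul, smul_sub]
  module

end Bosonic

end

/-- The quantum Rényi-`p` entropy power inequality for Gaussian states. -/
theorem theorem2 (D : ℕ) (hD : 0 < D) (τ : ℝ) (hτ : τ ∈ Set.Ioo (0 : ℝ) 1)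
    (ρX ρY : Bosonic.ModeSpace D →L[ℂ] Bosonic.ModeSpace D)
    (hX : Bosonic.IsGaussianState ρX) (hY : Bosonic.IsGaussianState ρY)
    (s : ℝ)
    (hsX : 0 < s → Integrable (Bosonic.charFnOrd s ρX))
    (hsY : 0 < s → Integrable (Bosonic.charFnOrd s ρY))
    (p κ : ℝ) (hp : 1 < p) (hκ : (p + 1) / 2 ≤ κ) :
    Bosonic.IsGaussianState (Bosonic.qconv τ hτ ρX ρY) ∧
    (Bosonic.HasRenyiEntropy s p ρX ∧ Bosonic.HasRenyiEntropy s p ρY ∧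
      Bosonic.HasRenyiEntropy s p (Bosonic.qconv τ hτ ρX ρY)) ∧
    τ ^ κ * Bosonic.entropyPower s p ρX ^ κ + (1 - τ) ^ κ * Bosonic.entropyPower s p ρY ^ κ ≤
      Bosonic.entropyPower s p (Bosonic.qconv τ hτ ρX ρY) ^ κ := by
  obtain ⟨hρX, dX, VX, hVX, hcX⟩ := hX
  obtain ⟨hρY, dY, VY, hVY, hcY⟩ := hY
  have hτ0 : 0 < τ := hτ.1
  have hτ1 : 0 < 1 - τ := by linarith [hτ.2]
  have hcZ := Bosonic.HasGaussianCharFn.qconv hτ hρX hρY hcX hcY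
  have hAX := Bosonic.posDef_ordCov hρX hcX hVX hsX
  have hAY := Bosonic.posDef_ordCov hρY hcY hVY hsY
  have hAZ : (Bosonic.ordCov s (τ • VX + (1 - τ) • VY)).PosDef := by
    rw [Bosonic.ordCov_convex_comb]
    exact (hAX.smul hτ0).add (hAY.smul hτ1)
  obtain ⟨hRX, hPX⟩ := Bosonic.entropyPower_gaussian hD hcX hp hAX
  obtain ⟨hRY, hPY⟩ := Bosonic.entropyPower_gaussian hD hcY hp hAY
  obtain ⟨hRZ, hPZ⟩ := Bosonic.entropyPower_gaussian hD hcZ hp hAZ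
  have hne : Nonempty (Fin D × Fin 2) := ⟨(⟨0, hD⟩, 0)⟩
  -- The linear inequality, κ = 1, is Minkowski's inequality multiplied by the common constant
  -- `entropyConst D p`.
  have hlin : τ * Bosonic.entropyPower s p ρX + (1 - τ) * Bosonic.entropyPower s p ρY ≤
      Bosonic.entropyPower s p (Bosonic.qconv τ hτ ρX ρY) := by
    have hM := Bosonic.rpow_det_convex_comb_le hAX hAY hτ0 hτ1
    rw [← Bosonic.ordCov_convex_comb] at hM
    rw [hPX, hPY, hPZ]
    rw [mul_left_comm τ, mul_left_comm (1 - τ), ← mul_add]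
    exact mul_le_mul_of_nonneg_left hM (Real.exp_nonneg _)
  have h0 : ∀ ρ : Bosonic.ModeSpace D →L[ℂ] Bosonic.ModeSpace D,
      0 ≤ Bosonic.entropyPower s p ρ := fun ρ => Real.exp_nonneg _
  refine ⟨⟨(Bosonic.isDensityOperator_qconv hτ hρX hρY).1, _, _, ?_, hcZ⟩, ⟨hRX, hRY, hRZ⟩, ?_⟩
  · exact (hVX.smul τ).add (hVY.smul (1 - τ))
  · rw [← Real.mul_rpow hτ0.le (h0 _), ← Real.mul_rpow hτ1.le (h0 _)]
    -- Since p > 1, the bound (p+1)/2 exceeds 1, so t ↦ t^κ is superadditive and increasing on [0,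
    -- ∞).
    have hκ1 : 1 ≤ κ := by linarith
    exact (Real.add_rpow_le_rpow_add (mul_nonneg hτ0.le (h0 _)) (mul_nonneg hτ1.le (h0 _)) hκ1).trans
      (Real.rpow_le_rpow (add_nonneg (mul_nonneg hτ0.le (h0 _)) (mul_nonneg hτ1.le (h0 _))) hlin
        (by linarith))
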